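/- Let $R\ge 2$, $q\ge 1$, and consider the $R$ multivariate simple linear models $Y_r = X_r B_r+\varepsilon_r$, $r=1,\dots,R$, where $X_r=(\mathbf 1_{n_r},\,x_r)\in\mathbb R^{n_r\times 2}$ has rank $2$, $n_r>q+2$, $B_r\in\mathbb R^{2\times q}$ has rows $\alpha_r'$ and $\beta_r'$, and $\varepsilon_1,\dots,\varepsilon_R$ are independent with $\varepsilon_r\sim\mathcal N_{n_r\times q}(0,I_{n_r}\otimes\Sigma)$, $\Sigma>0$. Let $a,b$ be known constants, not both $0$, and let $0<\alpha<1$. Put $N=\sum_r n_r$, $\nu_H=R-1$, $\nu_E=N-2R$. Let $\hat B_r=X_r^-Y_r$ ($X_r^-$ the Moore–Penrose inverse) have rows $\hat\alpha_r',\hat\beta_r'$, let $Z\in\mathbb R^{R\times q}$ have rows $a\hat\alpha_r'+b\hat\beta_r'$, let $D=\mathrm{diag}(d_{11},\dots,d_{RR})$ with $$d_{rr}=\frac{n_r\,\|(I_{n_r}-\mathbf 1\mathbf 1'/n_r)x_r\|^2}{\|a x_r-b\mathbf 1_{n_r}\|^2},$$ and put $$S_E=\sum_{r=1}^R Y_r'(I_{n_r}-X_rX_r^-)Y_r,\qquad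 S_H=(D^{1/2}Z)'\Bigl(I_R-\frac{D^{1/2}\mathbf 1_R\mathbf 1_R'D^{1/2}}{\mathbf 1_R'D\mathbf 1_R}\Bigr)(D^{1/2}Z).$$ Set $$s=\min(q,\nu_H),\qquad m=\frac{|q-\nu_H|-1}{2},\qquad h=\frac{\nu_E-q-1}{2}.$$ Almost surely $S_E$ is positive definite and $S_HS_E^{-1}$ has, counted with multiplicity, exactly $s$ nonzero eigenvalues $\lambda_1\ge\dots\ge\lambda_s>0$; the $s$ largest eigenvalues of $S_H(S_H+S_E)^{-1}$ are $\theta_i=\lambda_i/(1+\lambda_i)$. For testing $$H_0:\ a\alpha_1+b\beta_1=\dots=a\alpha_R+b\beta_R\quad\text{against}\quad H_1:\ \text{at least one equality fails},$$ the following are tests of size $\alpha$ (each rejects with probability exactly $\alpha$ whatever the parameters $B_r,\Sigma$ satisfying $H_0$). 1. The union-intersection test (Roy's largest root test), which rejects if $\theta_1=\dfrac{\lambda_1}{1+\lambda_1}\ge\theta_{\alpha,s,m,h}$, where $\lambda_1$ is the largest eigenvalue of $S_HS_E^{-1}$. Here $H_0$ is the intersection over $c\in\mathbb R^q\setminus\{0\}$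 of the hypotheses $H_{0,c}$: "$(a\alpha_r+b\beta_r)'c$ does not depend on $r$". If $F_c$ is the usual univariate $F$ statistic of $H_{0,c}$ computed from the observations $Y_rc$ (extra residual sum of squares over $\nu_H$, divided by residual sum of squares over $\nu_E$), then $0<\theta_{\alpha,s,m,h}<1$ and, almost surely, for every $t<1$, $\theta_1\ge t$ if and only if $F_c\ge\frac{\nu_E}{\nu_H}\frac{t}{1-t}$ for some $c\ne0$. 2. Pillai's test, which rejects if $V^{(s)}\ge V^{(s)}_{\alpha,s,m,h}$, where almost surely $V^{(s)}=\mathrm{tr}[S_H(S_E+S_H)^{-1}]=\sum_{i=1}^s\frac{\lambda_i}{1+\lambda_i}=\sum_{i=1}^s\theta_i$. 3. The Lawley–Hotelling test, which rejects if $U^{(s)}\ge U^{(s)}_{\alpha,s,m,h}$, where almost surely $U^{(s)}=\mathrm{tr}[S_HS_E^{-1}]=\sum_{i=1}^s\lambda_i=\sum_{i=1}^s\frac{\theta_i}{1-\theta_i}$. The critical values $\theta_{\alpha,s,m,h}$, $V^{(s)}_{\alpha,s,m,h}$, $U^{(s)}_{\alpha,s,m,h}$ are the upper $\alpha$ points of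 the respective statistics under the reference distribution with parameters $s,m,h$, i.e. when $S_H,S_E$ are replaced by independent Wishart matrices $A\sim\mathcal W_s(s+2m+1,I_s)$ and $E\sim\mathcal W_s(s+2h+1,I_s)$ (equivalently, when $\theta_1>\dots>\theta_s$ in $(0,1)$ have joint density proportional to $\prod_i\theta_i^m(1-\theta_i)^h\prod_{i<j}(\theta_i-\theta_j)$). -/

import Mathlib

open MeasureTheory ProbabilityTheory Matrix
open scoped ENNReal BigOperators

noncomputable section

namespace MultiLines

/-! ### `R` multivariate simple linear models -/

/-- Observations (or errors) of the `R` models: the `r`-th entry is an `n r × q` matrix. -/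
abbrev Data {R : ℕ} (n : Fin R → ℕ) (q : ℕ) : Type :=
  (r : Fin R) → Matrix (Fin (n r)) (Fin q) ℝ

/-- Parameters: the `r`-th entry is the `2 × q` matrix whose row `0` is the intercept vector
`α_r'` and whose row `1` is the slope vector `β_r'`. -/
abbrev Params (R q : ℕ) : Type := Fin R → Matrix (Fin 2) (Fin q) ℝ

/-- The design matrix `(1, x)` of a simple linear model. -/
def design {k : ℕ} (x : Fin k → ℝ) : Matrix (Fin k) (Fin 2) ℝ :=
  Matrix.of fun i => ![1, x i]

/-- The Moore-Penrose inverse `(X'X)⁻¹X'` of a matrix of full column rank. -/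
def pinv {k p : ℕ} (X : Matrix (Fin k) (Fin p) ℝ) : Matrix (Fin p) (Fin k) ℝ :=
  (Xᵀ * X)⁻¹ * Xᵀ

/-- For a matrix of full column rank, `pinv` satisfies the four Penrose equations. -/
theorem pinv_penrose {k p : ℕ} (X : Matrix (Fin k) (Fin p) ℝ) (hX : X.rank = p) :
    X * pinv X * X = X ∧ pinv X * X * pinv X = pinv X ∧
      (X * pinv X)ᵀ = X * pinv X ∧ (pinv X * X)ᵀ = pinv X * X := by
  have hr : (Xᵀ * X).rank = p := by rw [Matrix.rank_transpose_mul_self, hX]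
  have hu : IsUnit (Xᵀ * X) := by
    rw [← Matrix.mulVec_surjective_iff_isUnit]
    have h : LinearMap.range (Xᵀ * X).mulVecLin = ⊤ := by
      apply Submodule.eq_top_of_finrank_eq
      rw [Module.finrank_fin_fun]
      exact hr
    intro v
    obtain ⟨w, hw⟩ := LinearMap.range_eq_top.mp h v
    exact ⟨w, hw⟩
  have hd : IsUnit (Xᵀ * X).det := (Matrix.isUnit_iff_isUnit_det _).mp hu
  have h1 : pinv X * X = 1 := by
    unfold pinv
    rw [Matrix.mul_assoc, Matrix.nonsing_inv_mul _ hd]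
  refine ⟨?_, ?_, ?_, ?_⟩
  · rw [Matrix.mul_assoc, h1, Matrix.mul_one]
  · rw [h1, Matrix.one_mul]
  · unfold pinv
    simp only [Matrix.transpose_mul, Matrix.transpose_nonsing_inv, Matrix.transpose_transpose,
      Matrix.mul_assoc]
  · rw [h1, Matrix.transpose_one]

/-- The models `Y_r = X_r B_r + ε_r`. -/
def response {R q : ℕ} {n : Fin R → ℕ} (x : (r : Fin R) → Fin (n r) → ℝ)
    (B : Params R q) (ε : Data n q) : Data n q :=
  fun r => design (x r) * B r + ε r

/-- The errors `ε_r` are independent with `ε_r ∼ N(0, I ⊗ Σ)`: all `N` rows of all the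
`ε_r` are independent and `N_q(0, Σ)`. -/
def NormalErrors {Ω : Type*} [MeasurableSpace Ω] (P : Measure Ω) {R q : ℕ} {n : Fin R → ℕ}
    (Sig : Matrix (Fin q) (Fin q) ℝ) (ε : Ω → Data n q) : Prop :=
  HasLaw (fun ω (p : (r : Fin R) × Fin (n r)) => WithLp.toLp 2 (ε ω p.1 p.2))
    (Measure.pi fun _ : (r : Fin R) × Fin (n r) =>
      multivariateGaussian (0 : EuclideanSpace ℝ (Fin q)) Sig) P

/-- The null hypothesis `a α_1 + b β_1 = ⋯ = a α_R + b β_R`. -/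
def NullHyp {R q : ℕ} (a b : ℝ) (B : Params R q) : Prop :=
  ∀ r r' : Fin R, a • B r 0 + b • B r 1 = a • B r' 0 + b • B r' 1

/-- The component null hypothesis in the direction `c`: the numbers `(a α_r + b β_r)'c` are
all equal. -/
def NullHypDir {R q : ℕ} (a b : ℝ) (B : Params R q) (c : Fin q → ℝ) : Prop :=
  ∀ r r' : Fin R, (a • B r 0 + b • B r 1) ⬝ᵥ c = (a • B r' 0 + b • B r' 1) ⬝ᵥ c

/-! ### The matrices of sums of squares and products -/

/-- The least squares estimators `B̂_r = X_r⁻ Y_r`. -/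
def estimator {R q : ℕ} {n : Fin R → ℕ} (x : (r : Fin R) → Fin (n r) → ℝ) (Y : Data n q) :
    Params R q :=
  fun r => pinv (design (x r)) * Y r

/-- `S_E = ∑_r Y_r' (I - X_r X_r⁻) Y_r`. -/
def matSE {R q : ℕ} {n : Fin R → ℕ} (x : (r : Fin R) → Fin (n r) → ℝ) (Y : Data n q) :
    Matrix (Fin q) (Fin q) ℝ :=
  ∑ r, (Y r)ᵀ * (1 - design (x r) * pinv (design (x r))) * Y r

/-- The squared Euclidean norm. -/
def normSq {k : ℕ} (v : Fin k → ℝ) : ℝ := ∑ i, v i ^ 2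

/-- The centring matrix `I - 11'/k`. -/
def centring (k : ℕ) : Matrix (Fin k) (Fin k) ℝ :=
  1 - (k : ℝ)⁻¹ • Matrix.of fun _ _ => (1 : ℝ)

/-- The weights `d_rr = n_r ‖(I - 11'/n_r) x_r‖² / ‖a x_r - b 1‖²`. -/
def weight {R : ℕ} {n : Fin R → ℕ} (x : (r : Fin R) → Fin (n r) → ℝ) (a b : ℝ)
    (r : Fin R) : ℝ :=
  (n r : ℝ) * normSq (centring (n r) *ᵥ x r) / normSq (fun i => a * x r i - b)

/-- The `R × q` matrix `Z` with rows `(a α̂_r + b β̂_r)'`. -/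
def matZ {R q : ℕ} {n : Fin R → ℕ} (x : (r : Fin R) → Fin (n r) → ℝ) (a b : ℝ)
    (Y : Data n q) : Matrix (Fin R) (Fin q) ℝ :=
  Matrix.of fun r => a • estimator x Y r 0 + b • estimator x Y r 1

/-- `D^{1/2}`. -/
def sqrtD {R : ℕ} {n : Fin R → ℕ} (x : (r : Fin R) → Fin (n r) → ℝ) (a b : ℝ) :
    Matrix (Fin R) (Fin R) ℝ :=
  Matrix.diagonal fun r => Real.sqrt (weight x a b r)

/-- `S_H = (D^{1/2}Z)' (I - D^{1/2}11'D^{1/2} / 1'D1) (D^{1/2}Z)`. -/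
def matSH {R q : ℕ} {n : Fin R → ℕ} (x : (r : Fin R) → Fin (n r) → ℝ) (a b : ℝ)
    (Y : Data n q) : Matrix (Fin q) (Fin q) ℝ :=
  (sqrtD x a b * matZ x a b Y)ᵀ *
    (1 - (∑ r, weight x a b r)⁻¹ •
      (sqrtD x a b * (Matrix.of fun _ _ => (1 : ℝ)) * sqrtD x a b)) *
    (sqrtD x a b * matZ x a b Y)

/-! ### The test statistics -/

/-- The `i`-th largest real eigenvalue of `A` (`i = 0, 1, …`), repeated according to algebraic
multiplicity; `0` if `A` has fewer than `i + 1` of them. -/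
def eig {p : ℕ} (A : Matrix (Fin p) (Fin p) ℝ) (i : ℕ) : ℝ :=
  (A.charpoly.roots.sort (· ≥ ·)).getD i 0

/-- `λ_{i+1}`, eigenvalue of `S_H S_E⁻¹`. -/
def lam {p : ℕ} (SH SE : Matrix (Fin p) (Fin p) ℝ) (i : ℕ) : ℝ := eig (SH * SE⁻¹) i

/-- `θ_{i+1}`, eigenvalue of `S_H (S_H + S_E)⁻¹`. -/
def theta {p : ℕ} (SH SE : Matrix (Fin p) (Fin p) ℝ) (i : ℕ) : ℝ := eig (SH * (SH + SE)⁻¹) i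

/-- Roy's largest root `θ_1`. -/
def royRoot {p : ℕ} (SH SE : Matrix (Fin p) (Fin p) ℝ) : ℝ := theta SH SE 0

/-- Pillai's trace. -/
def pillai {p : ℕ} (SH SE : Matrix (Fin p) (Fin p) ℝ) : ℝ := (SH * (SE + SH)⁻¹).trace

/-- The Lawley-Hotelling trace. -/
def lawleyHotelling {p : ℕ} (SH SE : Matrix (Fin p) (Fin p) ℝ) : ℝ := (SH * SE⁻¹).trace

/-! ### Critical values -/

/-- The law of a `k × p` matrix with independent standard normal entries. -/
def stdNormalMatrix (k p : ℕ) : Measure (Fin k → Fin p → ℝ) :=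
  Measure.pi fun _ => Measure.pi fun _ => gaussianReal 0 1

/-- Upper tail probability at `t` of a statistic `T` under the reference distribution with
parameters `s, m, h`, that is, of `T(A, B)` for independent Wishart matrices
`A = G'G ∼ W_s(s + 2m + 1, I)` and `B = E'E ∼ W_s(s + 2h + 1, I)`.  The roots of
`A(A + B)⁻¹` have joint density proportional to
`∏ θ_i ^ m (1 - θ_i) ^ h ∏_{i<j} (θ_i - θ_j)`.
(Used only where `2m + 1` and `2h + 1` are natural numbers.) -/
def refTail (T : {p : ℕ} → Matrix (Fin p) (Fin p) ℝ → Matrix (Fin p) (Fin p) ℝ → ℝ)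
    (s : ℕ) (m h : ℝ) (t : ℝ) : ℝ≥0∞ :=
  ((stdNormalMatrix (s + ⌊2 * m + 1⌋₊) s).prod (stdNormalMatrix (s + ⌊2 * h + 1⌋₊) s))
    {w | t ≤ T ((Matrix.of w.1)ᵀ * Matrix.of w.1) ((Matrix.of w.2)ᵀ * Matrix.of w.2)}

/-- The upper `α` point of the statistic `T` under the reference distribution with parameters
`s, m, h`. -/
def critical (T : {p : ℕ} → Matrix (Fin p) (Fin p) ℝ → Matrix (Fin p) (Fin p) ℝ → ℝ)
    (α : ℝ) (s : ℕ) (m h : ℝ) : ℝ :=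
  sSup {t : ℝ | ENNReal.ofReal α ≤ refTail T s m h t}

/-! ### The component tests of the union-intersection principle -/

/-- Sum of squared residuals of univariate observations `y` about the lines with
intercepts `γ r 0` and slopes `γ r 1`. -/
def residSq {R : ℕ} {n : Fin R → ℕ} (x : (r : Fin R) → Fin (n r) → ℝ)
    (y : (r : Fin R) → Fin (n r) → ℝ) (γ : Fin R → Fin 2 → ℝ) : ℝ :=
  ∑ r, ∑ i, (y r i - (γ r 0 + γ r 1 * x r i)) ^ 2

/-- Residual sum of squares of the unrestricted univariate models. -/
def rssFull {R : ℕ} {n : Fin R → ℕ} (x y : (r : Fin R) → Fin (n r) → ℝ) : ℝ :=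
  ⨅ γ : Fin R → Fin 2 → ℝ, residSq x y γ

/-- Residual sum of squares under the restriction that `a γ_{r0} + b γ_{r1}` does not depend
on `r`. -/
def rssNull {R : ℕ} {n : Fin R → ℕ} (x y : (r : Fin R) → Fin (n r) → ℝ) (a b : ℝ) : ℝ :=
  ⨅ γ : {γ : Fin R → Fin 2 → ℝ //
    ∀ r r' : Fin R, a * γ r 0 + b * γ r 1 = a * γ r' 0 + b * γ r' 1}, residSq x y γ.1

/-- The univariate `F` statistic, on `R - 1` and `N - 2R` degrees of freedom, for the component
hypothesis in the direction `c`, computed from the univariate observations `Y_r c`. -/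
def fStat {R q : ℕ} {n : Fin R → ℕ} (x : (r : Fin R) → Fin (n r) → ℝ) (a b : ℝ)
    (Y : Data n q) (c : Fin q → ℝ) : ℝ :=
  ((rssNull x (fun r => Y r *ᵥ c) a b - rssFull x (fun r => Y r *ᵥ c)) / ((R : ℝ) - 1)) /
    (rssFull x (fun r => Y r *ᵥ c) / (((∑ r, n r : ℕ) : ℝ) - 2 * R))

end MultiLines

end

namespace MultiLines

/-! ### Simultaneous diagonalisation -/

/-! Stack the observations of all models into one N × q matrix Y. Then S_E = Y'P_E Y and S_H = Y'P_H
Y, where P_E (`projE`) and P_H (`projH`) are orthogonal projections of ranks N - 2R and R - 1 with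
P_H P_E = 0. Indeed d_rr is the reciprocal of the squared length of the vector that produces aα̂_r +
bβ̂_r from Y_r (`weight_mul_contrast`), so D^{1/2}Z is the image of Y under a matrix with
orthonormal rows, and the middle factor of S_H is the projection orthogonal to D^{1/2}1. P_E always
kills the mean of Y. P_H kills it under H_0, because the mean of D^{1/2}Z then has columns
proportional to D^{1/2}1.

The errors are W M with W standard Gaussian and M invertible. Under H_0 the pair (S_H, S_E) is
therefore congruent, through M, to independent Wishart matrices W_q(R-1, I) and W_q(N-2R, I). The
three statistics depend only on the nonzero roots of A(A+B)⁻¹, which congruence preserves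
(`IsSpectralStat`, `nzRoots_conj`), so their null laws are free of all parameters.

The reference law lives in dimension s = min(q, R-1). If q ≤ R-1 it is the law just found. Otherwise
a duality is needed: for independent Gaussian G (q columns) and K (s columns), projecting G on the
range of K and projecting K on the range of G give the same nonzero roots (`nzRoots_hat`).
Conditioning on K or on G reads these roots as those of a Wishart pair in dimension q or s
(`wishartPair_duality`).

The size is exactly α because the statistics have no atoms. For fixed B they increase strictly as G
is scaled in A = G'G, so a level set meets each ray at most once and is Lebesgue null
(`volume_eq_zero_of_ray`, `wishartPair_atomless`). An atomless law exceeds its upper α point with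
probability α (`measure_sSup_le_eq`).

The almost sure identities follow from `exists_simultaneous_diagonalization`, which reduces
everything to a decreasing list of generalised eigenvalues. The number of positive ones is the rank
of S_H, which is min(q, R-1) almost surely, with or without H_0, because a shifted Gaussian matrix
has full rank (`ae_rank_add`). For the union-intersection form, F_c is ν_E/ν_H times the quotient
c'S_H c / c'S_E c (`fStat_eq`), whose maximum over c is λ_1. -/

theorem exists_orthogonal_diagonalization {ι : Type*} [Fintype ι] [DecidableEq ι]
    {A : Matrix ι ι ℝ} (hA : A.IsHermitian) :
    ∃ (U : Matrix ι ι ℝ) (e : ι → ℝ), U * Uᵀ = 1 ∧ Uᵀ * U = 1 ∧ A = U * diagonal e * Uᵀ := by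
  refine ⟨hA.eigenvectorUnitary, hA.eigenvalues, ?_, ?_, ?_⟩
  · have := Unitary.coe_mul_star_self hA.eigenvectorUnitary
    simpa [star_eq_conjTranspose] using this
  · have := Unitary.coe_star_mul_self hA.eigenvectorUnitary
    simpa [star_eq_conjTranspose] using this
  · have := hA.spectral_theorem
    rw [Unitary.conjStarAlgAut_apply] at this
    simpa [star_eq_conjTranspose, Function.comp_def] using this

theorem isUnit_det_of_mul_transpose {ι : Type*} [Fintype ι] [DecidableEq ι] {A B : Matrix ι ι ℝ}
    (h : A * B = 1) : IsUnit A.det := by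
  have := congrArg Matrix.det h
  rw [Matrix.det_mul, Matrix.det_one] at this
  exact IsUnit.of_mul_eq_one _ this

theorem quadForm_mul_diagonal {ι : Type*} [Fintype ι] [DecidableEq ι] (T : Matrix ι ι ℝ)
    (d c : ι → ℝ) :
    c ⬝ᵥ (T * diagonal d * Tᵀ) *ᵥ c = ∑ i, d i * (Tᵀ *ᵥ c) i ^ 2 := by
  rw [← mulVec_mulVec, ← mulVec_mulVec, dotProduct_mulVec, ← mulVec_transpose]
  simp only [dotProduct, mulVec_diagonal]
  exact Finset.sum_congr rfl fun i _ => by ring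

/-- Whiten `SE` as C C', diagonalise C⁻¹ `SH` C⁻ᵀ orthogonally, and transport back. With the
eigenvalues sorted, every statistic of the pair becomes an explicit function of `l`; later proofs
substitute this form. -/
theorem exists_simultaneous_diagonalization {p : ℕ} {SH SE : Matrix (Fin p) (Fin p) ℝ}
    (hH : SH.PosSemidef) (hE : SE.PosDef) :
    ∃ (T : Matrix (Fin p) (Fin p) ℝ) (l : Fin p → ℝ), IsUnit T.det ∧ Antitone l ∧ (∀ i, 0 ≤ l i) ∧
      SE = T * Tᵀ ∧ SH = T * diagonal l * Tᵀ := by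
  obtain ⟨U, e, hU1, hU2, hU⟩ := exists_orthogonal_diagonalization hE.isHermitian
  have he : ∀ i, 0 < e i := by
    have : (Uᵀ * SE * U).PosDef := by
      have := hE.conjTranspose_mul_mul_same (B := U)
        (Matrix.mulVec_injective_iff_isUnit.2 ((Matrix.isUnit_iff_isUnit_det _).2
          (isUnit_det_of_mul_transpose hU1)))
      simpa using this
    have h2 : Uᵀ * SE * U = diagonal e := by
      rw [hU]
      calc Uᵀ * (U * diagonal e * Uᵀ) * U = (Uᵀ * U) * diagonal e * (Uᵀ * U) := by
            simp only [Matrix.mul_assoc]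
        _ = _ := by rw [hU2, Matrix.one_mul, Matrix.mul_one]
    rw [h2, posDef_diagonal_iff] at this
    exact this
  set C := U * diagonal (fun i => √(e i)) with hC
  have hCE : SE = C * Cᵀ := by
    rw [hU, hC, transpose_mul, diagonal_transpose]
    calc _ = U * (diagonal (fun i => √(e i)) * diagonal (fun i => √(e i))) * Uᵀ := by
          rw [diagonal_mul_diagonal]
          congr 3
          ext i
          rw [Real.mul_self_sqrt (he i).le]
      _ = _ := by simp only [Matrix.mul_assoc]
  have hCd : IsUnit C.det := by
    have := hE.det_pos
    rw [hCE, det_mul, det_transpose] at this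
    exact isUnit_iff_ne_zero.2 fun h => by simp [h] at this
  have hN : (C⁻¹ * SH * C⁻¹ᵀ).PosSemidef := by
    have := hH.mul_mul_conjTranspose_same C⁻¹
    simpa only [conjTranspose_eq_transpose_of_trivial] using this
  obtain ⟨W, d, hW1, hW2, hW⟩ := exists_orthogonal_diagonalization hN.isHermitian
  have hd : ∀ i, 0 ≤ d i := by
    have : (Wᵀ * (C⁻¹ * SH * C⁻¹ᵀ) * W).PosSemidef := by
      have := hN.conjTranspose_mul_mul_same W
      simpa only [conjTranspose_eq_transpose_of_trivial] using this
    have h2 : Wᵀ * (C⁻¹ * SH * C⁻¹ᵀ) * W = diagonal d := by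
      rw [hW]
      calc Wᵀ * (W * diagonal d * Wᵀ) * W = (Wᵀ * W) * diagonal d * (Wᵀ * W) := by
            simp only [Matrix.mul_assoc]
        _ = _ := by rw [hW2, Matrix.one_mul, Matrix.mul_one]
    rw [h2, posSemidef_diagonal_iff] at this
    exact this
  -- Sorting `-d` increasingly arranges `d` decreasingly.
  set σ : Equiv.Perm (Fin p) := Tuple.sort (fun i => - d i) with hσ
  have hmono : Monotone ((fun i => - d i) ∘ σ) := Tuple.monotone_sort _
  set V := W.submatrix id σ with hV
  have hVV : V * Vᵀ = 1 := by
    rw [hV, transpose_submatrix, submatrix_mul_equiv, hW1, submatrix_id_id]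
  have hVd : V * diagonal (d ∘ σ) * Vᵀ = W * diagonal d * Wᵀ := by
    have : diagonal (d ∘ σ) = (diagonal d).submatrix σ σ := by
      rw [submatrix_diagonal_equiv]
    rw [this, hV, transpose_submatrix, submatrix_mul_equiv, submatrix_mul_equiv, submatrix_id_id]
  refine ⟨C * V, d ∘ σ, ?_, ?_, fun i => hd _, ?_, ?_⟩
  · rw [det_mul]
    exact hCd.mul (isUnit_det_of_mul_transpose hVV)
  · intro i j hij
    have := hmono hij
    simpa using this
  · rw [transpose_mul, hCE]
    calc C * Cᵀ = C * (V * Vᵀ) * Cᵀ := by rw [hVV, Matrix.mul_one]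
      _ = _ := by simp only [Matrix.mul_assoc]
  · rw [transpose_mul]
    calc SH = (C * C⁻¹) * SH * (C * C⁻¹)ᵀ := by
          rw [mul_nonsing_inv _ hCd, transpose_one, Matrix.one_mul, Matrix.mul_one]
      _ = C * (C⁻¹ * SH * C⁻¹ᵀ) * Cᵀ := by rw [transpose_mul]; simp only [Matrix.mul_assoc]
      _ = C * (V * diagonal (d ∘ σ) * Vᵀ) * Cᵀ := by rw [hW, hVd]
      _ = _ := by simp only [Matrix.mul_assoc]

/-! ### Eigenvalues of `T diag(d) T⁻¹` -/

theorem roots_charpoly_conj_diagonal {p : ℕ} {T : Matrix (Fin p) (Fin p) ℝ} (hT : IsUnit T.det)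
    (d : Fin p → ℝ) : (T * diagonal d * T⁻¹).charpoly.roots = Finset.univ.val.map d := by
  rw [charpoly_mul_comm, ← Matrix.mul_assoc, nonsing_inv_mul _ hT, Matrix.one_mul,
    charpoly_diagonal, ← Polynomial.roots_multiset_prod_X_sub_C (Finset.univ.val.map d)]
  simp only [Finset.prod, Multiset.map_map]
  rfl

/-- A decreasing `d` is already the sorted list of roots, so `eig` reads it by index; past the end
the default 0 of `getD` appears. -/
theorem eig_conj_diagonal {p : ℕ} {T : Matrix (Fin p) (Fin p) ℝ} (hT : IsUnit T.det)
    {d : Fin p → ℝ} (hd : Antitone d) (i : ℕ) :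
    eig (T * diagonal d * T⁻¹) i = if h : i < p then d ⟨i, h⟩ else 0 := by
  have h1 : (Finset.univ.val.map d).sort (· ≥ ·) = List.ofFn d := by
    have : (Finset.univ.val.map d : Multiset ℝ) = (List.ofFn d : List ℝ) := by
      simp [List.ofFn_eq_map]
    rw [this, Multiset.coe_sort]
    refine List.mergeSort_eq_self (r := (· ≥ ·)) ?_
    rw [List.pairwise_ofFn]
    exact fun i j hij => hd hij.le
  rw [eig, roots_charpoly_conj_diagonal hT, h1]
  split_ifs with h
  · rw [List.getD_eq_getElem _ _ (by simpa using h)]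
    simp
  · exact List.getD_eq_default _ _ (by simpa using h)

theorem trace_conj_diagonal {p : ℕ} {T : Matrix (Fin p) (Fin p) ℝ} (hT : IsUnit T.det)
    (d : Fin p → ℝ) : (T * diagonal d * T⁻¹).trace = ∑ i, d i := by
  rw [trace_mul_comm, ← Matrix.mul_assoc, nonsing_inv_mul _ hT, Matrix.one_mul, trace_diagonal]

section Diagonal

variable {p : ℕ} {T : Matrix (Fin p) (Fin p) ℝ} (hT : IsUnit T.det) {l : Fin p → ℝ}
  (hl : Antitone l) (h0 : ∀ i, 0 ≤ l i)

theorem mul_inv_of_congr_diagonal (hT : IsUnit T.det) {d : Fin p → ℝ} (hd : ∀ i, d i ≠ 0) :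
    (T * diagonal l * Tᵀ) * (T * diagonal d * Tᵀ)⁻¹ = T * diagonal (fun i => l i / d i) * T⁻¹ := by
  have hT' : IsUnit Tᵀ.det := by rwa [det_transpose]
  have hinv : (T * diagonal d * Tᵀ)⁻¹ = Tᵀ⁻¹ * diagonal (fun i => (d i)⁻¹) * T⁻¹ := by
    apply inv_eq_right_inv
    calc T * diagonal d * Tᵀ * (Tᵀ⁻¹ * diagonal (fun i => (d i)⁻¹) * T⁻¹)
        = T * diagonal d * (Tᵀ * Tᵀ⁻¹) * (diagonal (fun i => (d i)⁻¹) * T⁻¹) := by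
          simp only [Matrix.mul_assoc]
      _ = T * (diagonal d * diagonal (fun i => (d i)⁻¹)) * T⁻¹ := by
          rw [mul_nonsing_inv _ hT', Matrix.mul_one]; simp only [Matrix.mul_assoc]
      _ = 1 := by
          rw [diagonal_mul_diagonal]
          simp only [mul_inv_cancel₀ (hd _), diagonal_one, Matrix.mul_one, mul_nonsing_inv _ hT]
  rw [hinv]
  calc T * diagonal l * Tᵀ * (Tᵀ⁻¹ * diagonal (fun i => (d i)⁻¹) * T⁻¹)
      = T * diagonal l * (Tᵀ * Tᵀ⁻¹) * (diagonal (fun i => (d i)⁻¹) * T⁻¹) := by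
        simp only [Matrix.mul_assoc]
    _ = T * (diagonal l * diagonal (fun i => (d i)⁻¹)) * T⁻¹ := by
        rw [mul_nonsing_inv _ hT', Matrix.mul_one]; simp only [Matrix.mul_assoc]
    _ = _ := by rw [diagonal_mul_diagonal]; rfl

include hT in
theorem mul_inv_congr : (T * diagonal l * Tᵀ) * (T * Tᵀ)⁻¹ = T * diagonal l * T⁻¹ := by
  have := mul_inv_of_congr_diagonal (l := l) hT (d := fun _ => 1) (fun _ => one_ne_zero)
  simpa using this

include hT h0 in
theorem mul_add_inv_congr : (T * diagonal l * Tᵀ) * (T * diagonal l * Tᵀ + T * Tᵀ)⁻¹ =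
    T * diagonal (fun i => l i / (1 + l i)) * T⁻¹ := by
  rw [← mul_inv_of_congr_diagonal hT (d := fun i => 1 + l i)
    (fun i => by have := h0 i; positivity)]
  congr 2
  have : diagonal (fun i => 1 + l i) = 1 + diagonal l := by
    rw [← diagonal_one, diagonal_add]
  rw [this, Matrix.mul_add, Matrix.add_mul, Matrix.mul_one, add_comm]

theorem div_one_add_le_div_one_add {x y : ℝ} (hx : 0 ≤ x) (hxy : x ≤ y) :
    x / (1 + x) ≤ y / (1 + y) := by
  rw [div_le_div_iff₀ (by positivity) (by linarith)]
  nlinarith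

theorem div_one_add_lt_div_one_add {x y : ℝ} (hx : 0 ≤ x) (hxy : x < y) :
    x / (1 + x) < y / (1 + y) := by
  rw [div_lt_div_iff₀ (by positivity) (by linarith)]
  nlinarith

include hl h0 in
theorem antitone_div_one_add : Antitone fun i => l i / (1 + l i) := fun _ _ hij =>
  div_one_add_le_div_one_add (h0 _) (hl hij)

include hT hl in
theorem lam_congr (i : ℕ) : lam (T * diagonal l * Tᵀ) (T * Tᵀ) i =
    if h : i < p then l ⟨i, h⟩ else 0 := by
  rw [lam, mul_inv_congr hT, eig_conj_diagonal hT hl]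

include hT hl h0 in
theorem theta_congr (i : ℕ) : theta (T * diagonal l * Tᵀ) (T * Tᵀ) i =
    if h : i < p then l ⟨i, h⟩ / (1 + l ⟨i, h⟩) else 0 := by
  rw [theta, mul_add_inv_congr hT h0, eig_conj_diagonal hT (antitone_div_one_add hl h0)]

include hT hl h0 in
theorem royRoot_congr (hp : 0 < p) : royRoot (T * diagonal l * Tᵀ) (T * Tᵀ) =
    l ⟨0, hp⟩ / (1 + l ⟨0, hp⟩) := by
  rw [royRoot, theta_congr hT hl h0, dif_pos hp]

include hT h0 in
theorem pillai_congr : pillai (T * diagonal l * Tᵀ) (T * Tᵀ) = ∑ i, l i / (1 + l i) := by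
  rw [pillai, add_comm, mul_add_inv_congr hT h0, trace_conj_diagonal hT]

include hT in
theorem lawleyHotelling_congr : lawleyHotelling (T * diagonal l * Tᵀ) (T * Tᵀ) = ∑ i, l i := by
  rw [lawleyHotelling, mul_inv_congr hT, trace_conj_diagonal hT]

include hT h0 in
theorem roots_congr : ((T * diagonal l * Tᵀ) * (T * diagonal l * Tᵀ + T * Tᵀ)⁻¹).charpoly.roots =
    Finset.univ.val.map fun i => l i / (1 + l i) := by
  rw [mul_add_inv_congr hT h0, roots_charpoly_conj_diagonal hT]

end Diagonal

/-! ### Spectral statistics -/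

/-- The nonzero eigenvalues of `A (A + B)⁻¹`. -/
noncomputable def nzRoots {p : ℕ} (A B : Matrix (Fin p) (Fin p) ℝ) : Multiset ℝ :=
  (A * (A + B)⁻¹).charpoly.roots.filter (· ≠ 0)

/-- The product structure is used, so that product measures on functions `m → n → ℝ` are measures on
matrices as they stand. -/
instance instMeasurableSpaceMatrix {m n : Type*} : MeasurableSpace (Matrix m n ℝ) :=
  inferInstanceAs (MeasurableSpace (m → n → ℝ))

instance instBorelSpaceMatrix {m n : Type*} [Countable m] [Countable n] :
    BorelSpace (Matrix m n ℝ) :=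
  inferInstanceAs (BorelSpace (m → n → ℝ))

instance instSecondCountableMatrix {m n : Type*} [Countable m] [Countable n] :
    SecondCountableTopology (Matrix m n ℝ) :=
  inferInstanceAs (SecondCountableTopology (m → n → ℝ))

/-- Statistics of a positive semidefinite and a positive definite matrix that are measurable,
depend only on the nonzero eigenvalues of `A (A + B)⁻¹`, and increase strictly when `A ≠ 0` is
scaled up. -/
structure IsSpectralStat
    (T : {p : ℕ} → Matrix (Fin p) (Fin p) ℝ → Matrix (Fin p) (Fin p) ℝ → ℝ) : Prop where
  nonneg : ∀ {p : ℕ} {A B : Matrix (Fin p) (Fin p) ℝ}, 0 < p → A.PosSemidef → B.PosDef → 0 ≤ T A B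
  congr : ∀ {p p' : ℕ} {A B : Matrix (Fin p) (Fin p) ℝ} {A' B' : Matrix (Fin p') (Fin p') ℝ},
    0 < p → 0 < p' → A.PosSemidef → B.PosDef → A'.PosSemidef → B'.PosDef →
    nzRoots A B = nzRoots A' B' → T A B = T A' B'
  smul_lt : ∀ {p : ℕ} {A B : Matrix (Fin p) (Fin p) ℝ} {r r' : ℝ}, 0 < p → A.PosSemidef → B.PosDef →
    A ≠ 0 → 0 < r → r < r' → T (r • A) B < T (r' • A) B
  meas : ∀ {p : ℕ}, 0 < p → ∀ t : ℝ, MeasurableSet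
    {w : Matrix (Fin p) (Fin p) ℝ × Matrix (Fin p) (Fin p) ℝ |
      (w.1.PosSemidef ∧ w.2.PosDef) ∧ t ≤ T w.1 w.2}

theorem isClosed_posSemidef (p : ℕ) : IsClosed {A : Matrix (Fin p) (Fin p) ℝ | A.PosSemidef} := by
  have : {A : Matrix (Fin p) (Fin p) ℝ | A.PosSemidef} =
      {A | Aᵀ = A} ∩ ⋂ c : Fin p → ℝ, {A | 0 ≤ c ⬝ᵥ A *ᵥ c} := by
    ext A
    simp [posSemidef_iff_dotProduct_mulVec, IsHermitian]
  rw [this]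
  refine (isClosed_eq (by fun_prop) (by fun_prop)).inter (isClosed_iInter fun c => ?_)
  exact isClosed_le (by fun_prop) (by fun_prop)

theorem posDef_iff_posSemidef_det_ne_zero {p : ℕ} {A : Matrix (Fin p) (Fin p) ℝ} :
    A.PosDef ↔ A.PosSemidef ∧ A.det ≠ 0 := by
  refine ⟨fun h => ⟨h.posSemidef, h.det_pos.ne'⟩, fun ⟨h, hd⟩ => ?_⟩
  exact (h.posDef_iff_isUnit).2 ((isUnit_iff_isUnit_det _).2 (isUnit_iff_ne_zero.2 hd))

theorem measurableSet_posSemidef (p : ℕ) :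
    MeasurableSet {A : Matrix (Fin p) (Fin p) ℝ | A.PosSemidef} :=
  (isClosed_posSemidef p).measurableSet

theorem measurableSet_posDef (p : ℕ) :
    MeasurableSet {A : Matrix (Fin p) (Fin p) ℝ | A.PosDef} := by
  have : {A : Matrix (Fin p) (Fin p) ℝ | A.PosDef} =
      {A | A.PosSemidef} ∩ {A | A.det ≠ 0} := by
    ext A; exact posDef_iff_posSemidef_det_ne_zero
  rw [this]
  exact (measurableSet_posSemidef p).inter
    (isOpen_ne_fun (by fun_prop) (by fun_prop)).measurableSet

theorem measurableSet_good (p : ℕ) :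
    MeasurableSet {w : Matrix (Fin p) (Fin p) ℝ × Matrix (Fin p) (Fin p) ℝ |
      w.1.PosSemidef ∧ w.2.PosDef} :=
  (measurable_fst (measurableSet_posSemidef p)).inter (measurable_snd (measurableSet_posDef p))

theorem measurable_matrix_inv (p : ℕ) :
    Measurable fun A : Matrix (Fin p) (Fin p) ℝ => A⁻¹ := by
  have : (fun A : Matrix (Fin p) (Fin p) ℝ => A⁻¹) = fun A => (A.det)⁻¹ • A.adjugate := by
    ext A : 1
    rw [inv_def, Ring.inverse_eq_inv']
  rw [this]
  have h1 : Measurable fun A : Matrix (Fin p) (Fin p) ℝ => A.det :=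
    (Continuous.matrix_det continuous_id).measurable
  have h2 : Measurable fun A : Matrix (Fin p) (Fin p) ℝ => A.adjugate :=
    (Continuous.matrix_adjugate continuous_id).measurable
  refine measurable_pi_lambda _ fun i => measurable_pi_lambda _ fun j => ?_
  exact (h1.inv).mul ((measurable_pi_apply j).comp ((measurable_pi_apply i).comp h2))

theorem measurable_matrixMul {α : Type*} [MeasurableSpace α] {l m n : Type*} [Fintype m] [Countable l] [Countable n]
    {f : α → Matrix l m ℝ} {g : α → Matrix m n ℝ} (hf : Measurable f) (hg : Measurable g) :
    Measurable fun a => f a * g a := by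
  have hc : Continuous fun w : Matrix l m ℝ × Matrix m n ℝ => w.1 * w.2 :=
    continuous_fst.matrix_mul continuous_snd
  exact hc.measurable.comp (hf.prodMk hg)

theorem smul_congr_diagonal {p : ℕ} (T : Matrix (Fin p) (Fin p) ℝ) (l : Fin p → ℝ) (r : ℝ) :
    r • (T * diagonal l * Tᵀ) = T * diagonal (fun i => r * l i) * Tᵀ := by
  have : diagonal (fun i => r * l i) = r • diagonal l := by
    rw [← diagonal_smul]; rfl
  rw [this, Matrix.mul_smul, Matrix.smul_mul]

theorem exists_pos_of_congr_ne_zero {p : ℕ} {T : Matrix (Fin p) (Fin p) ℝ} {l : Fin p → ℝ}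
    (h0 : ∀ i, 0 ≤ l i) (h : T * diagonal l * Tᵀ ≠ 0) : ∃ i, 0 < l i := by
  by_contra! hc
  apply h
  have : l = 0 := funext fun i => le_antisymm (hc i) (h0 i)
  simp [this]

/-- Dropping zero roots costs nothing when `f 0 = 0`. Both traces are sums of this kind, hence
functions of `nzRoots`. -/
theorem sum_filter_map_ne_zero {ι : Type*} [Fintype ι] (d : ι → ℝ) (f : ℝ → ℝ) (hf : f 0 = 0) :
    (((Finset.univ.val.map d).filter (· ≠ 0)).map f).sum = ∑ i, f (d i) := by
  have : (Finset.univ.val.map d).map f = Finset.univ.val.map fun i => f (d i) := by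
    rw [Multiset.map_map]; rfl
  change _ = (Finset.univ.val.map fun i => f (d i)).sum
  rw [← this]
  generalize Finset.univ.val.map d = S
  induction S using Multiset.induction_on with
  | empty => simp
  | cons a S ih =>
    by_cases ha : a = 0
    · subst ha; simpa [hf] using ih
    · rw [Multiset.filter_cons_of_pos _ (by exact ha)]
      simpa using ih

/-! ### The three statistics as spectral statistics -/

theorem pillai_eq_sum_nzRoots {p : ℕ} {A B : Matrix (Fin p) (Fin p) ℝ}
    (hA : A.PosSemidef) (hB : B.PosDef) : pillai A B = ((nzRoots A B).map fun x => x).sum := by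
  obtain ⟨T, l, hT, hl, h0, rfl, rfl⟩ := exists_simultaneous_diagonalization hA hB
  rw [pillai_congr hT h0, nzRoots, roots_congr hT h0, sum_filter_map_ne_zero _ _ rfl]

theorem lawleyHotelling_eq_sum_nzRoots {p : ℕ} {A B : Matrix (Fin p) (Fin p) ℝ}
    (hA : A.PosSemidef) (hB : B.PosDef) :
    lawleyHotelling A B = ((nzRoots A B).map fun x => x / (1 - x)).sum := by
  obtain ⟨T, l, hT, hl, h0, rfl, rfl⟩ := exists_simultaneous_diagonalization hA hB
  rw [lawleyHotelling_congr hT, nzRoots, roots_congr hT h0, sum_filter_map_ne_zero _ _ (by simp)]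
  refine Finset.sum_congr rfl fun i _ => ?_
  have : 1 + l i ≠ 0 := by have := h0 i; positivity
  field_simp
  ring

/-- These properties pin down the largest root as the maximum of the nonzero roots, or 0 if there
are none. The description does not mention `p`, so matrices of different sizes can be compared. -/
theorem royRoot_nzRoots {p : ℕ} (hp : 0 < p) {A B : Matrix (Fin p) (Fin p) ℝ}
    (hA : A.PosSemidef) (hB : B.PosDef) :
    0 ≤ royRoot A B ∧ (∀ x ∈ nzRoots A B, x ≤ royRoot A B) ∧
      (royRoot A B = 0 ∨ royRoot A B ∈ nzRoots A B) := by
  obtain ⟨T, l, hT, hl, h0, rfl, rfl⟩ := exists_simultaneous_diagonalization hA hB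
  rw [royRoot_congr hT hl h0 hp, nzRoots, roots_congr hT h0]
  refine ⟨div_nonneg (h0 _) (by have := h0 ⟨0, hp⟩; positivity), fun x hx => ?_, ?_⟩
  · obtain ⟨hx, -⟩ := Multiset.mem_filter.1 hx
    obtain ⟨i, -, rfl⟩ := Multiset.mem_map.1 hx
    exact antitone_div_one_add hl h0 (Fin.mk_le_of_le_val (Nat.zero_le _))
  · rw [or_iff_not_imp_left]
    exact fun h => Multiset.mem_filter.2 ⟨Multiset.mem_map.2 ⟨_, by simp, rfl⟩, h⟩

/-- The Rayleigh quotient bound. For each `c` the condition is closed in the pair `(A, B)`, which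
gives measurability of the largest root without examining sorted polynomial roots. -/
theorem royRoot_le_iff {p : ℕ} (hp : 0 < p) {A B : Matrix (Fin p) (Fin p) ℝ}
    (hA : A.PosSemidef) (hB : B.PosDef) (t : ℝ) :
    royRoot A B ≤ t ↔ ∀ c : Fin p → ℝ, c ⬝ᵥ A *ᵥ c ≤ t * (c ⬝ᵥ (A + B) *ᵥ c) := by
  obtain ⟨T, l, hT, hl, h0, rfl, rfl⟩ := exists_simultaneous_diagonalization hA hB
  have hsum : T * diagonal l * Tᵀ + T * Tᵀ = T * diagonal (fun i => 1 + l i) * Tᵀ := by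
    have : diagonal (fun i => 1 + l i) = 1 + diagonal l := by
      rw [← diagonal_one, diagonal_add]
    rw [this, Matrix.mul_add, Matrix.add_mul, Matrix.mul_one, add_comm]
  rw [royRoot_congr hT hl h0 hp, hsum]
  simp only [quadForm_mul_diagonal]
  constructor
  · intro h c
    rw [Finset.mul_sum]
    refine Finset.sum_le_sum fun i _ => ?_
    have h1 : l i / (1 + l i) ≤ t :=
      (antitone_div_one_add hl h0 (Fin.mk_le_of_le_val (Nat.zero_le _))).trans h
    rw [div_le_iff₀ (by have := h0 i; positivity)] at h1
    nlinarith [sq_nonneg ((Tᵀ *ᵥ c) i)]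
  · intro h
    have hT' : IsUnit Tᵀ.det := by rwa [det_transpose]
    have := h (Tᵀ⁻¹ *ᵥ Pi.single ⟨0, hp⟩ 1)
    rw [mulVec_mulVec, mul_nonsing_inv _ hT', one_mulVec] at this
    rw [div_le_iff₀ (by have := h0 ⟨0, hp⟩; positivity)]
    simpa [Pi.single_apply, ite_pow] using this

theorem measurableSet_le_of_measurableSet_ge {α : Type*} [MeasurableSpace α] {G : α → Prop}
    {f : α → ℝ} (hG : MeasurableSet {w | G w}) (h : ∀ t, MeasurableSet {w | G w ∧ f w ≤ t}) (t : ℝ) :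
    MeasurableSet {w | G w ∧ t ≤ f w} := by
  have : {w | G w ∧ t ≤ f w} = {w | G w} \ ⋃ k : ℕ, {w | G w ∧ f w ≤ t - 1 / (k + 1)} := by
    ext w
    simp only [Set.mem_ofPred_eq, Set.mem_sdiff, Set.mem_iUnion, not_exists, not_and, not_le]
    refine ⟨fun ⟨h1, h2⟩ => ⟨h1, fun k _ => ?_⟩, fun ⟨h1, h2⟩ => ⟨h1, ?_⟩⟩
    · have : (0 : ℝ) < 1 / (k + 1) := by positivity
      linarith
    · by_contra! hc
      obtain ⟨k, hk⟩ := exists_nat_one_div_lt (sub_pos.2 hc)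
      have := h2 k h1
      linarith
  rw [this]
  exact hG.diff (MeasurableSet.iUnion fun k => h _)

theorem measurable_trace (p : ℕ) : Measurable fun A : Matrix (Fin p) (Fin p) ℝ => A.trace :=
  (Continuous.matrix_trace continuous_id).measurable

theorem isSpectralStat_royRoot : IsSpectralStat royRoot where
  nonneg hp hA hB := (royRoot_nzRoots hp hA hB).1
  congr := by
    intro p p' A B A' B' hp hp' hA hB hA' hB' h
    obtain ⟨h1, h2, h3⟩ := royRoot_nzRoots hp hA hB
    obtain ⟨h1', h2', h3'⟩ := royRoot_nzRoots hp' hA' hB'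
    rw [h] at h2 h3
    apply le_antisymm
    · rcases h3 with h3 | h3
      · rwa [h3]
      · exact h2' _ h3
    · rcases h3' with h3 | h3
      · rwa [h3]
      · exact h2 _ h3
  smul_lt := by
    intro p A B r r' hp hA hB hne hr hrr
    obtain ⟨T, l, hT, hl, h0, rfl, rfl⟩ := exists_simultaneous_diagonalization hA hB
    obtain ⟨i, hi⟩ := exists_pos_of_congr_ne_zero h0 hne
    have hl0 : 0 < l ⟨0, hp⟩ := hi.trans_le (hl (Fin.mk_le_of_le_val (Nat.zero_le _)))
    have hr' := hr.trans hrr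
    rw [smul_congr_diagonal, smul_congr_diagonal,
      royRoot_congr hT (fun i j hij => mul_le_mul_of_nonneg_left (hl hij) hr.le)
        (fun i => mul_nonneg hr.le (h0 i)) hp,
      royRoot_congr hT (fun i j hij => mul_le_mul_of_nonneg_left (hl hij) hr'.le)
        (fun i => mul_nonneg hr'.le (h0 i)) hp]
    exact div_one_add_lt_div_one_add (by positivity) (mul_lt_mul_of_pos_right hrr hl0)
  meas := by
    intro p hp t
    refine measurableSet_le_of_measurableSet_ge (measurableSet_good p) (fun t => ?_) t
    have : {w : Matrix (Fin p) (Fin p) ℝ × Matrix (Fin p) (Fin p) ℝ |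
        (w.1.PosSemidef ∧ w.2.PosDef) ∧ royRoot w.1 w.2 ≤ t} =
        {w | w.1.PosSemidef ∧ w.2.PosDef} ∩
          ⋂ c : Fin p → ℝ, {w | c ⬝ᵥ w.1 *ᵥ c ≤ t * (c ⬝ᵥ (w.1 + w.2) *ᵥ c)} := by
      ext w
      simp only [Set.mem_ofPred_eq, Set.mem_inter_iff, Set.mem_iInter]
      exact and_congr_right fun h => royRoot_le_iff hp h.1 h.2 t
    rw [this]
    refine (measurableSet_good p).inter (IsClosed.measurableSet (isClosed_iInter fun c => ?_))
    exact isClosed_le (by fun_prop) (by fun_prop)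

theorem isSpectralStat_pillai : IsSpectralStat pillai where
  nonneg := by
    intro p A B hp hA hB
    obtain ⟨T, l, hT, hl, h0, rfl, rfl⟩ := exists_simultaneous_diagonalization hA hB
    rw [pillai_congr hT h0]
    exact Finset.sum_nonneg fun i _ => div_nonneg (h0 i) (by have := h0 i; positivity)
  congr := by
    intro p p' A B A' B' hp hp' hA hB hA' hB' h
    rw [pillai_eq_sum_nzRoots hA hB, pillai_eq_sum_nzRoots hA' hB', h]
  smul_lt := by
    intro p A B r r' hp hA hB hne hr hrr
    obtain ⟨T, l, hT, hl, h0, rfl, rfl⟩ := exists_simultaneous_diagonalization hA hB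
    obtain ⟨i, hi⟩ := exists_pos_of_congr_ne_zero h0 hne
    have hr' := hr.trans hrr
    rw [smul_congr_diagonal, smul_congr_diagonal, pillai_congr hT fun i => mul_nonneg hr.le (h0 i),
      pillai_congr hT fun i => mul_nonneg hr'.le (h0 i)]
    refine Finset.sum_lt_sum (fun j _ => ?_) ⟨i, Finset.mem_univ _, ?_⟩
    · exact div_one_add_le_div_one_add (mul_nonneg hr.le (h0 j))
        (mul_le_mul_of_nonneg_right hrr.le (h0 j))
    · exact div_one_add_lt_div_one_add (by positivity) (mul_lt_mul_of_pos_right hrr hi)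
  meas := by
    intro p hp t
    have hm : Measurable fun w : Matrix (Fin p) (Fin p) ℝ × Matrix (Fin p) (Fin p) ℝ =>
        pillai w.1 w.2 :=
      (measurable_trace p).comp (measurable_matrixMul measurable_fst ((measurable_matrix_inv p).comp
        (continuous_snd.add continuous_fst).measurable))
    exact (measurableSet_good p).inter (measurableSet_le measurable_const hm)

theorem isSpectralStat_lawleyHotelling : IsSpectralStat lawleyHotelling where
  nonneg := by
    intro p A B hp hA hB
    obtain ⟨T, l, hT, hl, h0, rfl, rfl⟩ := exists_simultaneous_diagonalization hA hB
    rw [lawleyHotelling_congr hT]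
    exact Finset.sum_nonneg fun i _ => h0 i
  congr := by
    intro p p' A B A' B' hp hp' hA hB hA' hB' h
    rw [lawleyHotelling_eq_sum_nzRoots hA hB, lawleyHotelling_eq_sum_nzRoots hA' hB', h]
  smul_lt := by
    intro p A B r r' hp hA hB hne hr hrr
    obtain ⟨T, l, hT, hl, h0, rfl, rfl⟩ := exists_simultaneous_diagonalization hA hB
    obtain ⟨i, hi⟩ := exists_pos_of_congr_ne_zero h0 hne
    rw [smul_congr_diagonal, smul_congr_diagonal, lawleyHotelling_congr hT,
      lawleyHotelling_congr hT]
    exact Finset.sum_lt_sum (fun j _ => mul_le_mul_of_nonneg_right hrr.le (h0 j))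
      ⟨i, Finset.mem_univ _, mul_lt_mul_of_pos_right hrr hi⟩
  meas := by
    intro p hp t
    have hm : Measurable fun w : Matrix (Fin p) (Fin p) ℝ × Matrix (Fin p) (Fin p) ℝ =>
        lawleyHotelling w.1 w.2 :=
      (measurable_trace p).comp (measurable_matrixMul measurable_fst ((measurable_matrix_inv p).comp
        measurable_snd))
    exact (measurableSet_good p).inter (measurableSet_le measurable_const hm)

/-! ### Nonzero eigenvalues and products in the reverse order -/

theorem filter_roots_X_pow_mul {f : Polynomial ℝ} (hf : f ≠ 0) (k : ℕ) :
    (Polynomial.X ^ k * f).roots.filter (· ≠ 0) = f.roots.filter (· ≠ 0) := by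
  rw [Polynomial.roots_mul (mul_ne_zero (pow_ne_zero _ Polynomial.X_ne_zero) hf),
    Multiset.filter_add, Polynomial.roots_X_pow]
  simp [Multiset.nsmul_singleton, Multiset.filter_eq_nil, Multiset.mem_replicate]

/-- The characteristic polynomials of AB and BA agree up to powers of X, which contribute only zero
roots. -/
theorem filter_roots_charpoly_mul_comm {m n : Type*} [Fintype m] [Fintype n] [DecidableEq m]
    [DecidableEq n] (A : Matrix m n ℝ) (B : Matrix n m ℝ) :
    (A * B).charpoly.roots.filter (· ≠ 0) = (B * A).charpoly.roots.filter (· ≠ 0) := by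
  rw [← filter_roots_X_pow_mul (A * B).charpoly_monic.ne_zero (Fintype.card n),
    charpoly_mul_comm', filter_roots_X_pow_mul (B * A).charpoly_monic.ne_zero]

/-- A(A+B)⁻¹ turns into its conjugate by M', so the roots are unchanged. This removes the unknown Σ
from the null law. -/
theorem nzRoots_conj {p : ℕ} {M : Matrix (Fin p) (Fin p) ℝ} (hM : IsUnit M.det)
    (A B : Matrix (Fin p) (Fin p) ℝ) : nzRoots (Mᵀ * A * M) (Mᵀ * B * M) = nzRoots A B := by
  have hM' : IsUnit Mᵀ.det := by rwa [det_transpose]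
  have : Mᵀ * A * M * (Mᵀ * A * M + Mᵀ * B * M)⁻¹ = Mᵀ * (A * (A + B)⁻¹ * Mᵀ⁻¹) := by
    rw [← Matrix.add_mul, ← Matrix.mul_add, Matrix.mul_inv_rev, Matrix.mul_inv_rev]
    calc Mᵀ * A * M * (M⁻¹ * ((A + B)⁻¹ * Mᵀ⁻¹))
        = Mᵀ * A * (M * M⁻¹) * ((A + B)⁻¹ * Mᵀ⁻¹) := by simp only [Matrix.mul_assoc]
      _ = _ := by rw [mul_nonsing_inv _ hM, Matrix.mul_one]; simp only [Matrix.mul_assoc]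
  rw [nzRoots, this, filter_roots_charpoly_mul_comm, Matrix.mul_assoc, nonsing_inv_mul _ hM',
    Matrix.mul_one, nzRoots]

/-- The orthogonal projection onto the column space of a matrix of full column rank. -/
noncomputable def hat {ι : Type*} [Fintype ι] {p : ℕ} (K : Matrix ι (Fin p) ℝ) : Matrix ι ι ℝ :=
  K * (Kᵀ * K)⁻¹ * Kᵀ

/-- The two forms add up to G'G, so the matrix is G'K (K'K)⁻¹ K'G (G'G)⁻¹. Moving the first factor
G'K to the end and transposing exchanges the roles of G and K; the nonzero roots are the squared
canonical correlations of the two column spaces. -/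
theorem nzRoots_hat {ι : Type*} [Fintype ι] [DecidableEq ι] {p s : ℕ} (G : Matrix ι (Fin p) ℝ)
    (K : Matrix ι (Fin s) ℝ) :
    nzRoots (Gᵀ * hat K * G) (Gᵀ * (1 - hat K) * G) =
      nzRoots (Kᵀ * hat G * K) (Kᵀ * (1 - hat G) * K) := by
  have h1 : ∀ {a b : ℕ} (G : Matrix ι (Fin a) ℝ) (K : Matrix ι (Fin b) ℝ),
      Gᵀ * hat K * G * (Gᵀ * hat K * G + Gᵀ * (1 - hat K) * G)⁻¹ =
        (Gᵀ * K) * ((Kᵀ * K)⁻¹ * Kᵀ * G * (Gᵀ * G)⁻¹) := by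
    intro a b G K
    rw [← Matrix.add_mul, ← Matrix.mul_add, add_sub_cancel, Matrix.mul_one, hat]
    simp only [Matrix.mul_assoc]
  rw [nzRoots, nzRoots, h1, h1, filter_roots_charpoly_mul_comm, ← charpoly_transpose]
  congr 3
  simp only [transpose_mul, transpose_nonsing_inv, transpose_transpose, Matrix.mul_assoc]

theorem transpose_hat {ι : Type*} [Fintype ι] {p : ℕ} (K : Matrix ι (Fin p) ℝ) :
    (hat K)ᵀ = hat K := by
  simp only [hat, transpose_mul, transpose_nonsing_inv, transpose_transpose, Matrix.mul_assoc]

theorem hat_mul_self {ι : Type*} [Fintype ι] {p : ℕ} {K : Matrix ι (Fin p) ℝ}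
    (hK : IsUnit (Kᵀ * K).det) : hat K * hat K = hat K := by
  calc hat K * hat K = K * (Kᵀ * K)⁻¹ * ((Kᵀ * K) * (Kᵀ * K)⁻¹) * Kᵀ := by
        simp only [hat, Matrix.mul_assoc]
    _ = hat K := by rw [mul_nonsing_inv _ hK, Matrix.mul_one, hat]

theorem trace_hat {ι : Type*} [Fintype ι] {p : ℕ} {K : Matrix ι (Fin p) ℝ}
    (hK : IsUnit (Kᵀ * K).det) : (hat K).trace = p := by
  rw [hat, Matrix.mul_assoc, trace_mul_comm, Matrix.mul_assoc, nonsing_inv_mul _ hK, trace_one,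
    Fintype.card_fin]

/-! ### Gaussian matrices -/

/-- The law of a matrix with independent standard normal entries. -/
noncomputable def gauss (ι κ : Type*) [Fintype ι] [Fintype κ] : Measure (Matrix ι κ ℝ) :=
  Measure.pi fun _ : ι => Measure.pi fun _ : κ => gaussianReal 0 1

instance {ι κ : Type*} [Fintype ι] [Fintype κ] : IsProbabilityMeasure (gauss ι κ) :=
  inferInstanceAs (IsProbabilityMeasure
    (Measure.pi fun _ : ι => Measure.pi fun _ : κ => gaussianReal 0 1))

/-- The law enters only through the sum of squares of the coefficients of `L`, so preserving the law
reduces to preserving this sum. -/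
theorem charFunDual_gauss {ι κ : Type*} [Fintype ι] [Fintype κ] [DecidableEq ι] [DecidableEq κ]
    (L : StrongDual ℝ (ι → κ → ℝ)) :
    charFunDual (Measure.pi fun _ : ι => Measure.pi fun _ : κ => gaussianReal 0 1) L =
      Complex.exp (-((∑ i, ∑ j, L (Pi.single i (Pi.single j 1)) ^ 2 : ℝ) : ℂ) / 2) := by
  have h1 : ∀ l : StrongDual ℝ ℝ, charFunDual (gaussianReal 0 1) l =
      Complex.exp (-((l 1 ^ 2 : ℝ) : ℂ) / 2) := by
    intro l
    have : l = InnerProductSpace.toDualMap ℝ ℝ (l 1) := by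
      ext; simp
    rw [this, ← charFun_eq_charFunDual_toDualMap, charFun_gaussianReal]
    simp [neg_div]
  rw [charFunDual_pi]
  simp_rw [charFunDual_pi, h1, ← Complex.exp_sum]
  congr 1
  push_cast
  rw [neg_div, Finset.sum_div, ← Finset.sum_neg_distrib]
  refine Finset.sum_congr rfl fun i _ => ?_
  rw [Finset.sum_div, ← Finset.sum_neg_distrib]
  refine Finset.sum_congr rfl fun j _ => ?_
  simp [neg_div]

/-- Left multiplication by a matrix, as a continuous linear map. -/
noncomputable def mulLeftCLM {ι ι' : Type*} [Fintype ι] [Fintype ι'] (κ : Type*) [Fintype κ]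
    (V : Matrix ι' ι ℝ) : (ι → κ → ℝ) →L[ℝ] (ι' → κ → ℝ) :=
  LinearMap.toContinuousLinearMap
    { toFun := fun G => (V * (Matrix.of G) : Matrix ι' κ ℝ)
      map_add' := fun G H => Matrix.mul_add V (Matrix.of G) (Matrix.of H)
      map_smul' := fun r G => Matrix.mul_smul V r (Matrix.of G) }

theorem mulLeftCLM_single {ι ι' κ : Type*} [Fintype ι] [Fintype ι'] [Fintype κ] [DecidableEq ι]
    [DecidableEq κ] [DecidableEq ι'] (V : Matrix ι' ι ℝ) (i : ι) (j : κ) :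
    mulLeftCLM κ V (Pi.single i (Pi.single j 1)) =
      ∑ a, V a i • (Pi.single a (Pi.single j 1) : ι' → κ → ℝ) := by
  ext a b
  change ∑ k, V a k * (Pi.single i (Pi.single j (1 : ℝ)) : ι → κ → ℝ) k b = _
  rw [Finset.sum_apply, Finset.sum_apply]
  rw [Finset.sum_eq_single i (fun k _ hk => by simp [hk]) (by simp),
    Finset.sum_eq_single a (fun k _ hk => by simp [Pi.single_eq_of_ne hk.symm]) (by simp)]
  simp

theorem sum_sq_mul_of_mul_transpose {ι α : Type*} [Fintype ι] [Fintype α] [DecidableEq α]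
    {V : Matrix α ι ℝ} (hV : V * Vᵀ = 1) (u : α → ℝ) :
    ∑ i, (∑ a, V a i * u a) ^ 2 = ∑ a, u a ^ 2 := by
  have h : (Vᵀ *ᵥ u) ⬝ᵥ (Vᵀ *ᵥ u) = u ⬝ᵥ u := by
    rw [dotProduct_mulVec, ← mulVec_transpose, transpose_transpose, mulVec_mulVec, hV, one_mulVec]
  simpa [dotProduct, mulVec, sq] using h

/-- V and W stacked have orthonormal rows, and the transpose of such a matrix preserves sums of
squares. Applied to each column, this matches the characteristic functions. -/
theorem map_gauss_semiorthogonal {ι κ α β : Type*} [Fintype ι] [Fintype κ] [Fintype α] [Fintype β]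
    [DecidableEq α] [DecidableEq β]
    {V : Matrix α ι ℝ} {W : Matrix β ι ℝ} (hV : V * Vᵀ = 1) (hW : W * Wᵀ = 1) (hVW : V * Wᵀ = 0) :
    (gauss ι κ).map (fun G => (V * G, W * G)) = (gauss α κ).prod (gauss β κ) := by
  classical
  change (Measure.pi fun _ : ι => Measure.pi fun _ : κ => gaussianReal 0 1).map
    ((mulLeftCLM κ V).prod (mulLeftCLM κ W)) =
    (Measure.pi fun _ : α => Measure.pi fun _ : κ => gaussianReal 0 1).prod
      (Measure.pi fun _ : β => Measure.pi fun _ : κ => gaussianReal 0 1)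
  have : IsProbabilityMeasure ((Measure.pi fun _ : ι => Measure.pi fun _ : κ =>
      gaussianReal 0 1).map ((mulLeftCLM κ V).prod (mulLeftCLM κ W))) :=
    Measure.isProbabilityMeasure_map (by fun_prop)
  apply Measure.ext_of_charFunDual
  ext L
  rw [charFunDual_map, charFunDual_prod, charFunDual_gauss, charFunDual_gauss, charFunDual_gauss,
    ← Complex.exp_add]
  congr 1
  rw [← add_div, ← neg_add, ← Complex.ofReal_add]
  congr 3
  -- Left multiplication acts on each column separately, so the column index `j` is brought outside
  -- and fixed.
  rw [Finset.sum_comm, Finset.sum_comm (s := (Finset.univ : Finset α)),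
    Finset.sum_comm (s := (Finset.univ : Finset β)), ← Finset.sum_add_distrib]
  refine Finset.sum_congr rfl fun j _ => ?_
  have hS : Matrix.fromRows V W * (Matrix.fromRows V W)ᵀ = 1 := by
    have hWV : W * Vᵀ = 0 := by
      have := congrArg transpose hVW
      simpa using this
    rw [transpose_fromRows, fromRows_mul_fromCols, hV, hW, hVW, hWV, fromBlocks_one]
  have := sum_sq_mul_of_mul_transpose hS (Sum.elim
    (fun a => L (Pi.single a (Pi.single j 1), 0)) (fun b => L (0, Pi.single b (Pi.single j 1))))
  simp only [Fintype.sum_sum_type, fromRows_apply_inl, fromRows_apply_inr, Sum.elim_inl,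
    Sum.elim_inr] at this
  simp only [ContinuousLinearMap.comp_apply, ContinuousLinearMap.inl_apply,
    ContinuousLinearMap.inr_apply]
  rw [← this]
  refine Finset.sum_congr rfl fun i _ => ?_
  congr 1
  have h2 : ((mulLeftCLM κ V).prod (mulLeftCLM κ W)) (Pi.single i (Pi.single j 1)) =
      ∑ a, V a i • ((Pi.single a (Pi.single j 1), 0) : (α → κ → ℝ) × (β → κ → ℝ)) +
      ∑ b, W b i • ((0, Pi.single b (Pi.single j 1)) : (α → κ → ℝ) × (β → κ → ℝ)) := by
    rw [ContinuousLinearMap.prod_apply, mulLeftCLM_single, mulLeftCLM_single]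
    ext1 <;> simp [Prod.fst_sum, Prod.snd_sum]
  rw [h2, map_add, map_sum, map_sum]
  simp only [map_smul, smul_eq_mul]

theorem measurable_mul_left {ι κ α : Type*} [Fintype ι] [Countable κ] [Countable α]
    (V : Matrix α ι ℝ) : Measurable fun G : Matrix ι κ ℝ => V * G :=
  measurable_matrixMul measurable_const measurable_id

/-- The joint statement with a `W` that has no rows. -/
theorem map_gauss_mul_left {ι κ α : Type*} [Fintype ι] [Fintype κ] [Fintype α] [DecidableEq α]
    {V : Matrix α ι ℝ} (hV : V * Vᵀ = 1) : (gauss ι κ).map (fun G => V * G) = gauss α κ := by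
  have := congrArg (Measure.map Prod.fst) (map_gauss_semiorthogonal (κ := κ)
    (W := (0 : Matrix (Fin 0) ι ℝ)) hV (Subsingleton.elim _ _) (Subsingleton.elim _ _))
  rw [Measure.map_map measurable_fst ((measurable_mul_left _).prodMk (measurable_mul_left _)),
    ← Measure.fst, Measure.fst_prod] at this
  exact this

/-- The eigenvalues of a projection are 0 and 1, and the trace counts the ones. The rows of `V` are
orthonormal eigenvectors for the eigenvalue 1. -/
theorem exists_semiorthogonal {ι : Type*} [Fintype ι] [DecidableEq ι] {P : Matrix ι ι ℝ}
    (hP : Pᵀ = P) (hPP : P * P = P) {k : ℕ} (hk : P.trace = k) :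
    ∃ V : Matrix (Fin k) ι ℝ, V * Vᵀ = 1 ∧ Vᵀ * V = P := by
  obtain ⟨U, e, hU1, hU2, hU⟩ := exists_orthogonal_diagonalization (A := P) (by
    rw [IsHermitian, conjTranspose_eq_transpose_of_trivial, hP])
  have hD : diagonal e = Uᵀ * P * U := by
    rw [hU]
    calc diagonal e = (Uᵀ * U) * diagonal e * (Uᵀ * U) := by
          rw [hU2, Matrix.one_mul, Matrix.mul_one]
      _ = _ := by simp only [Matrix.mul_assoc]
  have he : ∀ i, e i = 0 ∨ e i = 1 := by
    intro i
    have : diagonal e * diagonal e = diagonal e := by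
      calc diagonal e * diagonal e = Uᵀ * P * (U * Uᵀ) * P * U := by
            rw [hD]; simp only [Matrix.mul_assoc]
        _ = Uᵀ * (P * P) * U := by rw [hU1, Matrix.mul_one]; simp only [Matrix.mul_assoc]
        _ = _ := by rw [hPP, hD]
    rw [diagonal_mul_diagonal] at this
    have := congrFun (diagonal_injective this) i
    rcases eq_or_ne (e i) 0 with h | h
    · exact Or.inl h
    · exact Or.inr (mul_left_cancel₀ h (by simpa using this))
  have hcard : Fintype.card {i // e i = 1} = k := by
    have h1 : P.trace = ∑ i, e i := by
      rw [hU, Matrix.mul_assoc, trace_mul_comm, Matrix.mul_assoc, hU2, Matrix.mul_one,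
        trace_diagonal]
    have h2 : ∑ i, e i = ∑ i, if e i = 1 then (1 : ℝ) else 0 :=
      Finset.sum_congr rfl fun i _ => by rcases he i with h | h <;> simp [h]
    rw [Fintype.card_subtype]
    rw [h1, h2, Finset.sum_boole] at hk
    exact_mod_cast hk
  let f : Fin k ≃ {i // e i = 1} := (Fintype.equivFinOfCardEq hcard).symm
  refine ⟨Uᵀ.submatrix (fun a => (f a).1) id, ?_, ?_⟩
  · ext a b
    have : (Uᵀ * U) (f a).1 (f b).1 = (1 : Matrix ι ι ℝ) (f a).1 (f b).1 := by rw [hU2]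
    rw [mul_apply] at this ⊢
    simp only [submatrix_apply, transpose_apply, id] at this ⊢
    rw [this, one_apply, one_apply]
    simp [Subtype.coe_inj]
  · rw [hU]
    ext i j
    rw [mul_apply, mul_apply]
    simp only [transpose_apply, submatrix_apply, id, mul_diagonal]
    rw [f.sum_comp (fun x => U i x.1 * U j x.1)]
    have : ∀ x, U i x * e x * U j x = if e x = 1 then U i x * U j x else 0 := by
      intro x; rcases he x with h | h <;> simp [h]
    simp_rw [this]
    rw [← Finset.sum_filter, Finset.sum_subtype (p := fun x => e x = 1)]
    simp

/-- If `P₁`, `P₂` are orthogonal projections onto orthogonal spaces, then `G'P₁G` and `G'P₂G`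
are independent Wishart matrices. -/
theorem exists_map_gauss_projections {ι : Type*} [Fintype ι] [DecidableEq ι]
    {P₁ P₂ : Matrix ι ι ℝ} (h₁ : P₁ᵀ = P₁) (h₂ : P₂ᵀ = P₂) (h₁₁ : P₁ * P₁ = P₁)
    (h₂₂ : P₂ * P₂ = P₂) (h₁₂ : P₁ * P₂ = 0) {k₁ k₂ : ℕ} (hk₁ : P₁.trace = k₁) (hk₂ : P₂.trace = k₂) :
    ∃ (V : Matrix (Fin k₁) ι ℝ) (W : Matrix (Fin k₂) ι ℝ), V * Vᵀ = 1 ∧ W * Wᵀ = 1 ∧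
      Vᵀ * V = P₁ ∧ Wᵀ * W = P₂ ∧ ∀ p : ℕ, (gauss ι (Fin p)).map (fun G => (V * G, W * G)) =
      (gauss (Fin k₁) (Fin p)).prod (gauss (Fin k₂) (Fin p)) := by
  obtain ⟨V, hV, hV'⟩ := exists_semiorthogonal h₁ h₁₁ hk₁
  obtain ⟨W, hW, hW'⟩ := exists_semiorthogonal h₂ h₂₂ hk₂
  refine ⟨V, W, hV, hW, hV', hW', fun p => map_gauss_semiorthogonal hV hW ?_⟩
  -- The row spaces are the ranges of the two projections: V W' = V (V'V)(W'W) W' = V P₁P₂ W'.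
  calc V * Wᵀ = (V * Vᵀ) * V * (Wᵀ * (W * Wᵀ)) := by rw [hV, hW, Matrix.one_mul, Matrix.mul_one]
    _ = V * ((Vᵀ * V) * (Wᵀ * W)) * Wᵀ := by simp only [Matrix.mul_assoc]
    _ = 0 := by rw [hV', hW', h₁₂, Matrix.mul_zero, Matrix.zero_mul]

/-! ### Gaussian matrices have full rank almost surely -/

theorem pi_absolutelyContinuous {k : ℕ} {α : Type*} [MeasurableSpace α] {μ ν : Measure α}
    [SigmaFinite μ] [SigmaFinite ν] (h : μ ≪ ν) :
    (Measure.pi fun _ : Fin k => μ) ≪ Measure.pi fun _ : Fin k => ν := by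
  induction k with
  | zero =>
    rw [Measure.pi_of_empty, Measure.pi_of_empty]
  | succ k ih =>
    rw [← (measurePreserving_piFinSuccAbove (fun _ : Fin (k + 1) => μ) 0).symm.map_eq,
      ← (measurePreserving_piFinSuccAbove (fun _ : Fin (k + 1) => ν) 0).symm.map_eq]
    exact (h.prod ih).map (MeasurableEquiv.measurable _)

theorem pi_gaussianReal_absolutelyContinuous (p : ℕ) :
    (Measure.pi fun _ : Fin p => gaussianReal 0 1) ≪ (volume : Measure (Fin p → ℝ)) :=
  pi_absolutelyContinuous (gaussianReal_absolutelyContinuous 0 one_ne_zero)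

theorem gauss_absolutelyContinuous (k p : ℕ) :
    gauss (Fin k) (Fin p) ≪ (volume : Measure (Fin k → Fin p → ℝ)) :=
  pi_absolutelyContinuous (pi_gaussianReal_absolutelyContinuous p)

theorem ae_add_notMem_submodule {p : ℕ} (C : Fin p → ℝ) {W : Submodule ℝ (Fin p → ℝ)}
    (hW : W ≠ ⊤) : ∀ᵐ g ∂(Measure.pi fun _ : Fin p => gaussianReal 0 1), C + g ∉ W := by
  apply (pi_gaussianReal_absolutelyContinuous p).ae_le
  have h : ∀ᵐ g ∂(volume : Measure (Fin p → ℝ)), g ∉ W := by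
    rw [ae_iff]
    simpa using Measure.addHaar_submodule volume W hW
  exact (measurePreserving_add_left volume C).quasiMeasurePreserving.ae h

/-- Induction on the rows: fewer than `p` rows span a proper subspace, and a new independent
Gaussian row, even shifted, almost surely avoids it. The shift is needed for S_H away from the null
hypothesis. -/
theorem ae_linearIndependent_add {k p : ℕ} (hkp : k ≤ p) (C : Fin k → Fin p → ℝ) :
    ∀ᵐ G ∂(Measure.pi fun _ : Fin k => Measure.pi fun _ : Fin p => gaussianReal 0 1),
      LinearIndependent ℝ fun i => C i + G i := by
  induction k with
  | zero => exact Filter.Eventually.of_forall fun G => linearIndependent_empty_type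
  | succ k ih =>
    let e := MeasurableEquiv.piFinSuccAbove (fun _ : Fin (k + 1) => Fin p → ℝ) 0
    have hmp : MeasurePreserving e.symm _ _ := (measurePreserving_piFinSuccAbove
      (fun _ : Fin (k + 1) => Measure.pi fun _ : Fin p => gaussianReal 0 1) 0).symm
    have hopen : MeasurableSet
        {G : Fin (k + 1) → Fin p → ℝ | LinearIndependent ℝ fun i => C i + G i} :=
      (isOpen_setOfPred_linearIndependent.preimage
        (show Continuous fun (G : Fin (k + 1) → Fin p → ℝ) i => C i + G i by fun_prop)).measurableSet
    have hm := e.symm.measurable hopen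
    rw [← hmp.map_eq, ae_map_iff e.symm.measurable.aemeasurable hopen]
    -- Fubini, with the order exchanged so that the remaining rows `v` are fixed before the first
    -- row `x` is drawn.
    refine (Measure.ae_prod_iff_ae_ae hm).2 ((Measure.ae_ae_comm (p := fun x y => LinearIndependent ℝ fun i => C i + e.symm (x, y) i) hm).2 ?_)
    filter_upwards [ih (by omega) (fun i => C i.succ)] with v hv
    have hne : Submodule.span ℝ (Set.range fun i => C i.succ + v i) ≠ ⊤ := by
      intro h
      have h1 := finrank_range_le_card (R := ℝ) fun i => C i.succ + v i
      rw [Set.finrank, h, finrank_top, Module.finrank_fin_fun, Fintype.card_fin] at h1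
      omega
    filter_upwards [ae_add_notMem_submodule (C 0) hne] with x hx
    have : (fun i => C i + e.symm (x, v) i) = Fin.cons (C 0 + x) fun i => C i.succ + v i := by
      ext i : 1
      refine Fin.cases ?_ (fun j => ?_) i
      · rfl
      · rfl
    rw [this]
    exact linearIndependent_finCons.2 ⟨hv, hx⟩

theorem isUnit_det_of_rank {n : ℕ} {A : Matrix (Fin n) (Fin n) ℝ} (h : A.rank = n) :
    IsUnit A.det := by
  rw [← isUnit_iff_isUnit_det, ← linearIndependent_rows_iff_isUnit,
    linearIndependent_iff_card_eq_finrank_span, Set.finrank, ← rank_eq_finrank_span_row, h,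
    Fintype.card_fin]

theorem rank_eq_of_linearIndependent_rows {k p : ℕ} {M : Matrix (Fin k) (Fin p) ℝ}
    (h : LinearIndependent ℝ M.row) : M.rank = k := by
  rw [h.rank_matrix, Fintype.card_fin]

theorem ae_rank_add_of_le {k p : ℕ} (hkp : k ≤ p) (C : Matrix (Fin k) (Fin p) ℝ) :
    ∀ᵐ G ∂gauss (Fin k) (Fin p), (C + G).rank = k := by
  filter_upwards [ae_linearIndependent_add hkp C] with G hG
  exact rank_eq_of_linearIndependent_rows hG

theorem measurableSet_le_rank {k p : ℕ} (C : Matrix (Fin k) (Fin p) ℝ) :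
    MeasurableSet {G : Matrix (Fin k) (Fin p) ℝ | (C + G).rank = k} := by
  have : {G : Matrix (Fin k) (Fin p) ℝ | (C + G).rank = k} =
      {G : Matrix (Fin k) (Fin p) ℝ | ((C + G) * (C + G)ᵀ).det ≠ 0} := by
    ext G
    rw [Set.mem_ofPred_eq, Set.mem_ofPred_eq, ← rank_self_mul_transpose, ← isUnit_iff_ne_zero]
    refine ⟨isUnit_det_of_rank, fun h => ?_⟩
    rw [rank_of_isUnit _ ((isUnit_iff_isUnit_det _).2 h), Fintype.card_fin]
  rw [this]
  exact (isOpen_ne_fun (by fun_prop) (by fun_prop)).measurableSet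

/-- A shifted Gaussian matrix has maximal rank almost surely. -/
theorem ae_rank_add (k p : ℕ) (C : Matrix (Fin k) (Fin p) ℝ) :
    ∀ᵐ G ∂gauss (Fin k) (Fin p), (C + G).rank = min k p := by
  rcases le_total k p with hkp | hkp
  · rw [min_eq_left hkp]
    exact ae_rank_add_of_le hkp C
  · rw [min_eq_right hkp]
    -- `V` keeps the first `p` rows; their almost sure independence already forces rank `p`.
    let V : Matrix (Fin p) (Fin k) ℝ := (1 : Matrix (Fin k) (Fin k) ℝ).submatrix (Fin.castLE hkp) id
    have hV : V * Vᵀ = 1 := by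
      rw [transpose_submatrix, transpose_one,
        ← submatrix_mul _ _ _ id _ Function.bijective_id, Matrix.one_mul,
        submatrix_one _ (Fin.castLE_injective hkp)]
    have h := ae_rank_add_of_le le_rfl (V * C)
    rw [← map_gauss_mul_left hV, ae_map_iff (measurable_mul_left V).aemeasurable
      (measurableSet_le_rank _)] at h
    filter_upwards [h] with G hG
    refine le_antisymm ((rank_le_width _)) ?_
    rw [← Matrix.mul_add] at hG
    exact hG.symm.le.trans (rank_mul_le_right V (C + G))

theorem posDef_transpose_mul_self_of_rank {k p : ℕ} {G : Matrix (Fin k) (Fin p) ℝ}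
    (h : G.rank = p) : (Gᵀ * G).PosDef := by
  rw [posDef_iff_posSemidef_det_ne_zero]
  refine ⟨by simpa using posSemidef_conjTranspose_mul_self G, ?_⟩
  exact (isUnit_det_of_rank (by rw [rank_transpose_mul_self, h])).ne_zero

theorem ae_posDef_transpose_mul_self {k p : ℕ} (hkp : p ≤ k) :
    ∀ᵐ G ∂gauss (Fin k) (Fin p), (Gᵀ * G).PosDef := by
  filter_upwards [ae_rank_add k p 0] with G hG
  rw [zero_add, min_eq_right hkp] at hG
  exact posDef_transpose_mul_self_of_rank hG

theorem ae_ne_zero {k p : ℕ} (hk : 0 < k) (hp : 0 < p) :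
    ∀ᵐ G ∂gauss (Fin k) (Fin p), G ≠ 0 := by
  filter_upwards [ae_rank_add k p 0] with G hG h
  rw [h, zero_add, rank_zero] at hG
  omega

/-! ### Sets meeting every ray at most once -/

-- Take the bounded part A of S and dilate it by r_k = 1 + 1/(k+1). The dilates are pairwise
-- disjoint by the ray condition, lie in one ball because r_k ≤ 2, and each has measure at least
-- μ(A). Infinitely many of them fit into finite measure only if μ(A) = 0.
open scoped Pointwise in
theorem volume_eq_zero_of_ray {E : Type*} [NormedAddCommGroup E] [NormedSpace ℝ E]
    [FiniteDimensional ℝ E] [MeasurableSpace E] [BorelSpace E] (μ : Measure E) [μ.IsAddHaarMeasure]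
    {S : Set E} (hS : MeasurableSet S)
    (h : ∀ x ∈ S, ∀ r : ℝ, 1 < r → r • x ∉ S) : μ S = 0 := by
  have hball : ∀ N : ℕ, μ (S ∩ Metric.ball 0 N) = 0 := by
    intro N
    set A := S ∩ Metric.ball (0 : E) N with hA
    have hAm : MeasurableSet A := hS.inter Metric.isOpen_ball.measurableSet
    let r : ℕ → ℝ := fun k => 1 + 1 / ((k : ℝ) + 1)
    have hr1 : ∀ k, 1 < r k := fun k => by
      have : (0 : ℝ) < 1 / ((k : ℝ) + 1) := by positivity
      simp only [r]; linarith
    have hr2 : ∀ k, r k ≤ 2 := fun k => by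
      have : 1 / ((k : ℝ) + 1) ≤ 1 := by
        rw [div_le_one (by positivity)]; linarith [Nat.cast_nonneg (α := ℝ) k]
      simp only [r]; linarith
    have hr0 : ∀ k, r k ≠ 0 := fun k => by linarith [hr1 k]
    have hanti : ∀ i j, i < j → r j < r i := fun i j hij => by
      have : (1 : ℝ) / ((j : ℝ) + 1) < 1 / ((i : ℝ) + 1) :=
        one_div_lt_one_div_of_lt (by positivity) (by exact_mod_cast Nat.succ_lt_succ hij)
      simp only [r]; linarith
    have hdis0 : ∀ i j, i < j → Disjoint (r i • A) (r j • A) := by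
      intro i j hij
      rw [Set.disjoint_left]
      rintro _ ⟨x, hx, rfl⟩ ⟨y, hy, hxy⟩
      simp only at hxy
      have : y = (r i / r j) • x := by
        rw [div_eq_inv_mul, mul_smul, ← hxy, inv_smul_smul₀ (hr0 j)]
      refine h x hx.1 _ ?_ (this ▸ hy.1)
      rw [one_lt_div (by linarith [hr1 j])]
      exact hanti i j hij
    have hdis : Pairwise (Function.onFun Disjoint fun k => r k • A) := by
      intro i j hij
      rcases lt_or_gt_of_ne hij with h' | h'
      · exact hdis0 i j h'
      · exact (hdis0 j i h').symm
    have hsub : (⋃ k, r k • A) ⊆ Metric.ball (0 : E) (2 * N + 1) := by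
      refine Set.iUnion_subset fun k => ?_
      rintro _ ⟨x, hx, rfl⟩
      have hx2 : ‖x‖ < N := by simpa using hx.2
      rw [mem_ball_zero_iff, norm_smul, Real.norm_eq_abs, abs_of_pos (by linarith [hr1 k])]
      nlinarith [hr2 k, norm_nonneg x, hr1 k]
    have hfin : μ (⋃ k, r k • A) ≠ ∞ :=
      ((measure_mono hsub).trans_lt measure_ball_lt_top).ne
    rw [measure_iUnion hdis fun k => hAm.const_smul₀ (r k)] at hfin
    by_contra hne
    apply hfin
    refine top_unique ?_
    rw [← ENNReal.tsum_const_eq_top_of_ne_zero (α := ℕ) hne]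
    refine ENNReal.tsum_le_tsum fun k => ?_
    rw [Measure.addHaar_smul]
    refine le_mul_of_one_le_left zero_le ?_
    rw [ENNReal.one_le_ofReal, abs_of_nonneg (pow_nonneg (by linarith [hr1 k]) _)]
    exact one_le_pow₀ (hr1 k).le
  have : S = ⋃ N : ℕ, S ∩ Metric.ball 0 N := by
    rw [← Set.inter_iUnion, Metric.iUnion_ball_nat, Set.inter_univ]
  rw [this]
  exact measure_iUnion_null hball

/-! ### Upper quantiles of atomless laws -/

/-- The tail tends to 1 at -∞ and to 0 at +∞, so the supremum c is of a nonempty bounded set. Tails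
just below c are at least α, hence so is the tail at c by continuity from above. Tails beyond c are
below α, so P(f > c) ≤ α; the absence of an atom at c turns this into P(f ≥ c) ≤ α. -/
theorem measure_sSup_le_eq {X : Type*} [MeasurableSpace X] {μ : Measure X} [IsProbabilityMeasure μ]
    {f : X → ℝ} (hf : Measurable f) (hat : ∀ c, μ {x | f x = c} = 0) {α : ℝ} (h0 : 0 < α)
    (h1 : α < 1) :
    μ {x | sSup {t : ℝ | ENNReal.ofReal α ≤ μ {x | t ≤ f x}} ≤ f x} = ENNReal.ofReal α := by
  set S := {t : ℝ | ENNReal.ofReal α ≤ μ {x | t ≤ f x}} with hS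
  set c := sSup S with hc
  have hm : ∀ t, MeasurableSet {x | t ≤ f x} := fun t => measurableSet_le measurable_const hf
  have hanti : ∀ {t t' : ℝ}, t ≤ t' → μ {x | t' ≤ f x} ≤ μ {x | t ≤ f x} := fun h =>
    measure_mono fun x hx => h.trans hx
  have hne : S.Nonempty := by
    have hmono : Monotone fun k : ℕ => {x | -(k : ℝ) ≤ f x} := fun i j hij x hx => by
      have : (i : ℝ) ≤ j := by exact_mod_cast hij
      simp only [Set.mem_ofPred_eq] at hx ⊢
      linarith
    have ht := tendsto_measure_iUnion_atTop (μ := μ) hmono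
    have hu : ⋃ k : ℕ, {x | -(k : ℝ) ≤ f x} = Set.univ := by
      refine Set.eq_univ_of_forall fun x => Set.mem_iUnion.2 ?_
      obtain ⟨k, hk⟩ := exists_nat_ge (-f x)
      exact ⟨k, by simp only [Set.mem_ofPred_eq]; linarith⟩
    rw [hu, measure_univ] at ht
    obtain ⟨k, hk⟩ := (ht.eventually (lt_mem_nhds
      (show ENNReal.ofReal α < 1 by simpa using h1))).exists
    exact ⟨_, hk.le⟩
  have hbdd : BddAbove S := by
    have hmono : Antitone fun k : ℕ => {x | (k : ℝ) ≤ f x} := fun i j hij x hx => by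
      have : (i : ℝ) ≤ j := by exact_mod_cast hij
      simp only [Set.mem_ofPred_eq] at hx ⊢
      linarith
    have ht := tendsto_measure_iInter_atTop (μ := μ) (fun k => (hm _).nullMeasurableSet) hmono
      ⟨0, measure_ne_top _ _⟩
    have hu : ⋂ k : ℕ, {x | (k : ℝ) ≤ f x} = ∅ := by
      refine Set.eq_empty_of_forall_notMem fun x hx => ?_
      obtain ⟨k, hk⟩ := exists_nat_gt (f x)
      have := Set.mem_iInter.1 hx k
      simp only [Set.mem_ofPred_eq] at this
      linarith
    rw [hu, measure_empty] at ht
    obtain ⟨k, hk⟩ := (ht.eventually (gt_mem_nhds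
      (show 0 < ENNReal.ofReal α by simpa using h0))).exists
    refine ⟨k, fun t ht => ?_⟩
    by_contra! hlt
    exact absurd (ht.trans (hanti hlt.le)) (not_le.2 hk)
  apply le_antisymm
  · have h2 : μ {x | c ≤ f x} ≤ μ {x | c < f x} + μ {x | f x = c} := by
      refine (measure_mono fun x hx => ?_).trans (measure_union_le _ _)
      exact (lt_or_eq_of_le (α := ℝ) hx).imp id Eq.symm
    rw [hat, add_zero] at h2
    refine h2.trans ?_
    have hmono : Monotone fun k : ℕ => {x | c + 1 / ((k : ℝ) + 1) ≤ f x} := fun i j hij x hx => by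
      have : (1 : ℝ) / ((j : ℝ) + 1) ≤ 1 / ((i : ℝ) + 1) := Nat.one_div_le_one_div hij
      simp only [Set.mem_ofPred_eq] at hx ⊢
      linarith
    have ht := tendsto_measure_iUnion_atTop (μ := μ) hmono
    have hu : ⋃ k : ℕ, {x | c + 1 / ((k : ℝ) + 1) ≤ f x} = {x | c < f x} := by
      ext x
      simp only [Set.mem_iUnion, Set.mem_ofPred_eq]
      refine ⟨fun ⟨k, hk⟩ => ?_, fun h => ?_⟩
      · have : (0 : ℝ) < 1 / ((k : ℝ) + 1) := by positivity
        linarith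
      · obtain ⟨k, hk⟩ := exists_nat_one_div_lt (sub_pos.2 h)
        exact ⟨k, by linarith⟩
    rw [hu] at ht
    refine le_of_tendsto ht (Filter.Eventually.of_forall fun k => ?_)
    by_contra! hlt
    have hk : c + 1 / ((k : ℝ) + 1) ∈ S := hlt.le
    have : (0 : ℝ) < 1 / ((k : ℝ) + 1) := by positivity
    linarith [le_csSup hbdd hk]
  · have hmono : Antitone fun k : ℕ => {x | c - 1 / ((k : ℝ) + 1) ≤ f x} := fun i j hij x hx => by
      have : (1 : ℝ) / ((j : ℝ) + 1) ≤ 1 / ((i : ℝ) + 1) := Nat.one_div_le_one_div hij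
      simp only [Set.mem_ofPred_eq] at hx ⊢
      linarith
    have ht := tendsto_measure_iInter_atTop (μ := μ) (fun k => (hm _).nullMeasurableSet) hmono
      ⟨0, measure_ne_top _ _⟩
    have hu : ⋂ k : ℕ, {x | c - 1 / ((k : ℝ) + 1) ≤ f x} = {x | c ≤ f x} := by
      ext x
      simp only [Set.mem_iInter, Set.mem_ofPred_eq]
      refine ⟨fun h => ?_, fun h k => ?_⟩
      · by_contra! hlt
        obtain ⟨k, hk⟩ := exists_nat_one_div_lt (sub_pos.2 hlt)
        linarith [h k]
      · have : (0 : ℝ) < 1 / ((k : ℝ) + 1) := by positivity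
        linarith
    rw [hu] at ht
    refine ge_of_tendsto ht (Filter.Eventually.of_forall fun k => ?_)
    have : (0 : ℝ) < 1 / ((k : ℝ) + 1) := by positivity
    obtain ⟨t, htS, htc⟩ := exists_lt_of_lt_csSup hne (show c - 1 / ((k : ℝ) + 1) < c by linarith)
    exact le_trans htS (hanti htc.le)

/-! ### Pairs of independent Wishart matrices -/

/-- The pairs on which the statistics are considered. -/
def goodPairs (p : ℕ) : Set (Matrix (Fin p) (Fin p) ℝ × Matrix (Fin p) (Fin p) ℝ) :=
  {w | w.1.PosSemidef ∧ w.2.PosDef}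

open scoped Classical in
/-- A statistic, replaced by `0` off the good pairs. -/
noncomputable def onGood (T : {p : ℕ} → Matrix (Fin p) (Fin p) ℝ → Matrix (Fin p) (Fin p) ℝ → ℝ)
    {p : ℕ} (w : Matrix (Fin p) (Fin p) ℝ × Matrix (Fin p) (Fin p) ℝ) : ℝ :=
  if w ∈ goodPairs p then T w.1 w.2 else 0

theorem onGood_of_mem (T : {p : ℕ} → Matrix (Fin p) (Fin p) ℝ → Matrix (Fin p) (Fin p) ℝ → ℝ)
    {p : ℕ} {w : Matrix (Fin p) (Fin p) ℝ × Matrix (Fin p) (Fin p) ℝ} (h : w ∈ goodPairs p) :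
    onGood T w = T w.1 w.2 := if_pos h

section

variable {T : {p : ℕ} → Matrix (Fin p) (Fin p) ℝ → Matrix (Fin p) (Fin p) ℝ → ℝ}

theorem IsSpectralStat.measurable_onGood (hT : IsSpectralStat T) {p : ℕ} (hp : 0 < p) :
    Measurable fun w : Matrix (Fin p) (Fin p) ℝ × Matrix (Fin p) (Fin p) ℝ => onGood T w := by
  refine measurable_of_Ici fun t => ?_
  have : (fun w : Matrix (Fin p) (Fin p) ℝ × Matrix (Fin p) (Fin p) ℝ => onGood T w) ⁻¹' Set.Ici t =
      {w | (w.1.PosSemidef ∧ w.2.PosDef) ∧ t ≤ T w.1 w.2} ∪ ((goodPairs p)ᶜ ∩ {_w | t ≤ 0}) := by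
    ext w
    by_cases hw : w ∈ goodPairs p
    · have hw' : w.1.PosSemidef ∧ w.2.PosDef := hw
      simp [onGood_of_mem T hw, hw, hw']
    · have hw' : ¬ (w.1.PosSemidef ∧ w.2.PosDef) := hw
      simp only [Set.mem_preimage, Set.mem_Ici, onGood, if_false, Set.mem_union, Set.mem_ofPred_eq,
        Set.mem_inter_iff, Set.mem_compl_iff, hw', hw, false_and, false_or, not_false_eq_true,
        true_and]
  rw [this]
  exact (hT.meas hp t).union ((measurableSet_good p).compl.inter (MeasurableSet.const _))

/-- The joint law of independent `W_p(k₁, I)` and `W_p(k₂, I)` matrices. -/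
noncomputable def wishartPair (k₁ k₂ p : ℕ) :
    Measure (Matrix (Fin p) (Fin p) ℝ × Matrix (Fin p) (Fin p) ℝ) :=
  ((gauss (Fin k₁) (Fin p)).prod (gauss (Fin k₂) (Fin p))).map
    fun w => (w.1ᵀ * w.1, w.2ᵀ * w.2)

theorem measurable_gram (k p : ℕ) :
    Measurable fun G : Matrix (Fin k) (Fin p) ℝ => Gᵀ * G := by
  have : Continuous fun G : Matrix (Fin k) (Fin p) ℝ => Gᵀ * G := by fun_prop
  exact this.measurable

theorem measurable_gramPair (k₁ k₂ p : ℕ) :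
    Measurable fun w : Matrix (Fin k₁) (Fin p) ℝ × Matrix (Fin k₂) (Fin p) ℝ =>
      (w.1ᵀ * w.1, w.2ᵀ * w.2) :=
  ((measurable_gram k₁ p).comp measurable_fst).prodMk ((measurable_gram k₂ p).comp measurable_snd)

instance (k₁ k₂ p : ℕ) : IsProbabilityMeasure (wishartPair k₁ k₂ p) :=
  Measure.isProbabilityMeasure_map (measurable_gramPair k₁ k₂ p).aemeasurable

theorem posSemidef_gram {ι : Type*} [Fintype ι] {p : ℕ} (G : Matrix ι (Fin p) ℝ) :
    (Gᵀ * G).PosSemidef := by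
  simpa using posSemidef_conjTranspose_mul_self G

theorem ae_prod_gram_good {k₁ k₂ p : ℕ} (h : p ≤ k₂) :
    ∀ᵐ w ∂(gauss (Fin k₁) (Fin p)).prod (gauss (Fin k₂) (Fin p)),
      (w.1ᵀ * w.1, w.2ᵀ * w.2) ∈ goodPairs p := by
  have := Measure.quasiMeasurePreserving_snd (μ := gauss (Fin k₁) (Fin p)).ae
    (ae_posDef_transpose_mul_self h)
  filter_upwards [this] with w hw
  exact ⟨posSemidef_gram _, hw⟩

theorem ae_wishartPair_good {k₁ k₂ p : ℕ} (h : p ≤ k₂) :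
    ∀ᵐ w ∂wishartPair k₁ k₂ p, w ∈ goodPairs p := by
  rw [wishartPair]
  refine (ae_map_iff (p := (· ∈ goodPairs p)) (measurable_gramPair _ _ _).aemeasurable
    (measurableSet_good p)).2 ?_
  exact ae_prod_gram_good h

theorem refTail_eq (hT : IsSpectralStat T) {s k₁ k₂ : ℕ} (hs : 0 < s) {m h : ℝ}
    (hm : s + ⌊2 * m + 1⌋₊ = k₁) (hh : s + ⌊2 * h + 1⌋₊ = k₂) (t : ℝ) :
    refTail T s m h t = wishartPair k₁ k₂ s {w | t ≤ onGood T w} := by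
  subst hm hh
  rw [wishartPair, Measure.map_apply (measurable_gramPair _ _ _)
    (measurableSet_le measurable_const (hT.measurable_onGood hs))]
  refine measure_congr ?_
  filter_upwards [ae_prod_gram_good (p := s) (k₁ := s + ⌊2 * m + 1⌋₊)
    (Nat.le_add_right s ⌊2 * h + 1⌋₊)] with w hw
  refine propext ?_
  have := onGood_of_mem T hw
  exact iff_of_eq (congrArg (t ≤ ·) this.symm)

/-- Fix E with E'E positive definite. Replacing G by rG multiplies G'G by r², which strictly
increases the statistic when G ≠ 0 and r > 1. A level set thus meets each ray at most once and is
null for Lebesgue measure, hence for the Gaussian law. -/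
theorem wishartPair_atomless (hT : IsSpectralStat T) {k₁ k₂ p : ℕ} (hp : 0 < p) (hk : 0 < k₁)
    (h : p ≤ k₂) (c : ℝ) : wishartPair k₁ k₂ p {w | onGood T w = c} = 0 := by
  have hm : MeasurableSet {w : Matrix (Fin p) (Fin p) ℝ × Matrix (Fin p) (Fin p) ℝ |
      onGood T w = c} := hT.measurable_onGood hp (measurableSet_singleton c)
  rw [wishartPair, Measure.map_apply (measurable_gramPair _ _ _) hm,
    Measure.prod_apply_symm (measurable_gramPair _ _ _ hm)]
  refine (lintegral_congr_ae ?_).trans lintegral_zero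
  filter_upwards [ae_posDef_transpose_mul_self h] with E hE
  -- The zero matrix equals all its multiples and would violate the ray condition; it is removed at
  -- no cost in probability.
  set S : Set (Matrix (Fin k₁) (Fin p) ℝ) := {G | G ≠ 0 ∧ onGood T (Gᵀ * G, Eᵀ * E) = c} with hS
  have hle : gauss (Fin k₁) (Fin p) {G | onGood T (Gᵀ * G, Eᵀ * E) = c} ≤
      gauss (Fin k₁) (Fin p) S := by
    refine measure_mono_ae ?_
    filter_upwards [ae_ne_zero hk hp] with G hG h
    exact ⟨hG, h⟩
  refine le_antisymm (hle.trans (le_of_eq ?_)) (zero_le)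
  refine gauss_absolutelyContinuous k₁ p ?_
  have hSm : MeasurableSet S := by
    refine (measurableSet_singleton _).compl.inter ?_
    exact ((hT.measurable_onGood hp).comp
      ((measurable_gram k₁ p).prodMk measurable_const)) (measurableSet_singleton c)
  refine volume_eq_zero_of_ray (E := Fin k₁ → Fin p → ℝ) volume hSm fun G hG r hr hrG => ?_
  change Matrix (Fin k₁) (Fin p) ℝ at G
  obtain ⟨hG0, hGc⟩ := hG
  obtain ⟨-, hrGc⟩ := hrG
  have h1 : (r • G)ᵀ * (r • G) = r ^ 2 • (Gᵀ * G) := by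
    rw [transpose_smul, Matrix.smul_mul, Matrix.mul_smul, smul_smul, sq]
  have hg : ∀ H : Matrix (Fin k₁) (Fin p) ℝ, onGood T (Hᵀ * H, Eᵀ * E) = T (Hᵀ * H) (Eᵀ * E) :=
    fun H => onGood_of_mem T ⟨posSemidef_gram H, hE⟩
  have h2 : onGood T ((r • G)ᵀ * (r • G), Eᵀ * E) = c := hrGc
  rw [hg, h1] at h2
  rw [hg] at hGc
  have hne : Gᵀ * G ≠ 0 := fun h => hG0 (conjTranspose_mul_self_eq_zero.1 (by simpa using h))
  have := hT.smul_lt hp (posSemidef_gram G) hE hne one_pos (show 1 < r ^ 2 by nlinarith)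
  rw [one_smul, hGc, h2] at this
  exact lt_irrefl _ this

theorem map_gauss_eq_wishartPair {ι : Type*} [Fintype ι] [DecidableEq ι]
    {P₁ P₂ : Matrix ι ι ℝ} (h₁ : P₁ᵀ = P₁) (h₂ : P₂ᵀ = P₂) (h₁₁ : P₁ * P₁ = P₁)
    (h₂₂ : P₂ * P₂ = P₂) (h₁₂ : P₁ * P₂ = 0) {k₁ k₂ : ℕ} (hk₁ : P₁.trace = k₁) (hk₂ : P₂.trace = k₂)
    (p : ℕ) :
    (gauss ι (Fin p)).map (fun G => (Gᵀ * P₁ * G, Gᵀ * P₂ * G)) = wishartPair k₁ k₂ p := by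
  obtain ⟨V, W, -, -, hV, hW, h⟩ := exists_map_gauss_projections h₁ h₂ h₁₁ h₂₂ h₁₂ hk₁ hk₂
  rw [wishartPair, ← h p, Measure.map_map (measurable_gramPair _ _ _)
    ((measurable_mul_left _).prodMk (measurable_mul_left _))]
  congr 1
  ext1 G
  simp only [Function.comp, ← hV, ← hW, transpose_mul, Matrix.mul_assoc]

theorem trace_one_sub_hat {ι : Type*} [Fintype ι] [DecidableEq ι] {p k : ℕ} {K : Matrix ι (Fin p) ℝ}
    (hK : IsUnit (Kᵀ * K).det) (hι : Fintype.card ι = p + k) : (1 - hat K).trace = k := by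
  rw [trace_sub, trace_hat hK, trace_one, hι]
  push_cast
  ring

theorem map_gauss_hat {ι : Type*} [Fintype ι] [DecidableEq ι] {s k : ℕ} {K : Matrix ι (Fin s) ℝ}
    (hK : IsUnit (Kᵀ * K).det) (hι : Fintype.card ι = s + k) (p : ℕ) :
    (gauss ι (Fin p)).map (fun G => (Gᵀ * hat K * G, Gᵀ * (1 - hat K) * G)) =
      wishartPair s k p := by
  have h := hat_mul_self hK
  refine map_gauss_eq_wishartPair (transpose_hat K) ?_ h ?_ ?_ (trace_hat hK)
    (trace_one_sub_hat hK hι) p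
  · rw [transpose_sub, transpose_one, transpose_hat]
  · rw [Matrix.sub_mul, Matrix.one_mul, Matrix.mul_sub, h, Matrix.mul_one, sub_self, sub_zero]
  · rw [Matrix.mul_sub, Matrix.mul_one, h, sub_self]

theorem measurable_hatPair {α ι : Type*} [MeasurableSpace α] [Fintype ι] [DecidableEq ι] {p s : ℕ}
    {G : α → Matrix ι (Fin p) ℝ} {K : α → Matrix ι (Fin s) ℝ} (hG : Measurable G)
    (hK : Measurable K) :
    Measurable fun w => ((G w)ᵀ * hat (K w) * G w, (G w)ᵀ * (1 - hat (K w)) * G w) := by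
  have htr : ∀ {s : ℕ}, Measurable fun K : Matrix ι (Fin s) ℝ => Kᵀ := fun {s} =>
    (show Continuous fun K : Matrix ι (Fin s) ℝ => Kᵀ by fun_prop).measurable
  have hhat : Measurable fun w => hat (K w) :=
    measurable_matrixMul (measurable_matrixMul hK ((measurable_matrix_inv s).comp
      (measurable_matrixMul (htr.comp hK) hK))) (htr.comp hK)
  have hsub : Measurable fun w => 1 - hat (K w) :=
    (show Continuous fun A : Matrix ι ι ℝ => 1 - A by fun_prop).measurable.comp hhat
  exact (measurable_matrixMul (measurable_matrixMul (htr.comp hG) hhat) hG).prodMk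
    (measurable_matrixMul (measurable_matrixMul (htr.comp hG) hsub) hG)

theorem ae_isUnit_gram {ι : Type*} [Fintype ι] [DecidableEq ι] {s : ℕ} (h : s ≤ Fintype.card ι) :
    ∀ᵐ K ∂gauss ι (Fin s), IsUnit (Kᵀ * K).det := by
  let V : Matrix (Fin (Fintype.card ι)) ι ℝ :=
    (1 : Matrix ι ι ℝ).submatrix (Fintype.equivFin ι).symm id
  have hVV : Vᵀ * V = 1 := by
    rw [transpose_submatrix, submatrix_mul_equiv, transpose_one, Matrix.one_mul, submatrix_id_id]
  have hV : V * Vᵀ = 1 := by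
    rw [transpose_submatrix, transpose_one, ← submatrix_mul _ _ _ id _ Function.bijective_id,
      Matrix.one_mul, submatrix_one_equiv]
  have := ae_posDef_transpose_mul_self h
  rw [← map_gauss_mul_left hV] at this
  filter_upwards [ae_of_ae_map (measurable_mul_left V).aemeasurable this] with K hK
  have h1 : (V * K)ᵀ * (V * K) = Kᵀ * K := by
    rw [transpose_mul, Matrix.mul_assoc, ← Matrix.mul_assoc Vᵀ, hVV, Matrix.one_mul]
  rw [h1] at hK
  exact isUnit_iff_ne_zero.2 hK.det_pos.ne'

/-- The nonzero roots for `W_q(s)` against `W_q(k)` are distributed as those for `W_s(q)` against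
`W_s(l)` when `s + k = q + l`. -/
theorem wishartPair_duality (hT : IsSpectralStat T) {q s k l : ℕ} (hq : 0 < q) (hs : 0 < s)
    (hqk : q ≤ k) (h : s + k = q + l) (t : ℝ) :
    wishartPair s k q {w | t ≤ onGood T w} = wishartPair q l s {w | t ≤ onGood T w} := by
  let ι := Fin (s + k)
  have hι : Fintype.card ι = s + k := Fintype.card_fin _
  have hι' : Fintype.card ι = q + l := by rw [hι, h]
  have hmq : MeasurableSet {w | t ≤ onGood T (p := q) w} :=
    measurableSet_le measurable_const (hT.measurable_onGood hq)
  have hms : MeasurableSet {w | t ≤ onGood T (p := s) w} :=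
    measurableSet_le measurable_const (hT.measurable_onGood hs)
  let f : Matrix ι (Fin q) ℝ × Matrix ι (Fin s) ℝ → Matrix (Fin q) (Fin q) ℝ × Matrix (Fin q) (Fin q) ℝ :=
    fun w => (w.1ᵀ * hat w.2 * w.1, w.1ᵀ * (1 - hat w.2) * w.1)
  let g : Matrix ι (Fin q) ℝ × Matrix ι (Fin s) ℝ → Matrix (Fin s) (Fin s) ℝ × Matrix (Fin s) (Fin s) ℝ :=
    fun w => (w.2ᵀ * hat w.1 * w.2, w.2ᵀ * (1 - hat w.1) * w.2)
  have hf : Measurable f := measurable_hatPair measurable_fst measurable_snd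
  have hg : Measurable g := measurable_hatPair measurable_snd measurable_fst
  -- One probability space, read in two ways: conditionally on K, `f` has the law of a Wishart pair
  -- in dimension `q`; conditionally on G, `g` has that of one in dimension `s`. Neither conditional
  -- law depends on the frozen matrix, and `nzRoots_hat` equates the statistic of `f` with that of
  -- `g`.
  let μ := (gauss ι (Fin q)).prod (gauss ι (Fin s))
  have hmapf : ∀ D, MeasurableSet D → μ (f ⁻¹' D) = wishartPair s k q D := by
    intro D hD
    rw [Measure.prod_apply_symm (hf hD)]
    have : ∀ᵐ K ∂gauss ι (Fin s), gauss ι (Fin q) ((fun G => (G, K)) ⁻¹' (f ⁻¹' D)) =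
        wishartPair s k q D := by
      filter_upwards [ae_isUnit_gram (ι := ι) (s := s) (by omega)] with K hK
      rw [← map_gauss_hat hK hι, Measure.map_apply (measurable_hatPair (G := fun G => G)
        measurable_id measurable_const) hD]
      rfl
    rw [lintegral_congr_ae this, lintegral_const, measure_univ, mul_one]
  have hmapg : ∀ D, MeasurableSet D → μ (g ⁻¹' D) = wishartPair q l s D := by
    intro D hD
    rw [Measure.prod_apply (hg hD)]
    have : ∀ᵐ G ∂gauss ι (Fin q), gauss ι (Fin s) (Prod.mk G ⁻¹' (g ⁻¹' D)) =
        wishartPair q l s D := by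
      filter_upwards [ae_isUnit_gram (ι := ι) (s := q) (by omega)] with K hK
      rw [← map_gauss_hat hK hι', Measure.map_apply (measurable_hatPair (G := fun G => G)
        measurable_id measurable_const) hD]
      rfl
    rw [lintegral_congr_ae this, lintegral_const, measure_univ, mul_one]
  have hgoodf : ∀ᵐ w ∂μ, f w ∈ goodPairs q := by
    rw [ae_iff]
    have := hmapf _ (measurableSet_good q).compl
    exact this.trans (ae_iff.1 (ae_wishartPair_good hqk))
  have hgoodg : ∀ᵐ w ∂μ, g w ∈ goodPairs s := by
    rw [ae_iff]
    have := hmapg _ (measurableSet_good s).compl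
    exact this.trans (ae_iff.1 (ae_wishartPair_good (by omega)))
  rw [← hmapf _ hmq, ← hmapg _ hms]
  refine measure_congr ?_
  filter_upwards [hgoodf, hgoodg] with w hw hw'
  have h1 : onGood T (f w) = onGood T (g w) := by
    rw [onGood_of_mem T hw, onGood_of_mem T hw']
    exact hT.congr hq hs hw.1 hw.2 hw'.1 hw'.2 (nzRoots_hat w.1 w.2)
  exact congrArg (t ≤ ·) h1

/-- The upper tail of a spectral statistic of independent `W_q(k₁, I)` and `W_q(k₂, I)` matrices is
the reference tail. -/
theorem refTail_eq_wishartPair (hT : IsSpectralStat T) {q k₁ k₂ s : ℕ} (hq : 0 < q) (hk₁ : 0 < k₁)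
    (hqk : q ≤ k₂) (hs : s = min q k₁) {m h : ℝ} (hm : m = (|(q : ℝ) - k₁| - 1) / 2)
    (hh : h = ((k₂ : ℝ) - q - 1) / 2) (t : ℝ) :
    refTail T s m h t = wishartPair k₁ k₂ q {w | t ≤ onGood T w} := by
  have hfh : ⌊2 * h + 1⌋₊ = k₂ - q := by
    rw [hh, show 2 * (((k₂ : ℝ) - q - 1) / 2) + 1 = ((k₂ - q : ℕ) : ℝ) by
      rw [Nat.cast_sub hqk]; ring, Nat.floor_natCast]
  rcases le_total q k₁ with hle | hle
  -- Here s = q, so s + 2m + 1 = k₁ and s + 2h + 1 = k₂: the reference pair is the given one.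
  · have hfm : ⌊2 * m + 1⌋₊ = k₁ - q := by
      rw [hm, abs_of_nonpos (by simpa using hle),
        show 2 * ((-((q : ℝ) - k₁) - 1) / 2) + 1 = ((k₁ - q : ℕ) : ℝ) by
          rw [Nat.cast_sub hle]; ring, Nat.floor_natCast]
    rw [min_eq_left hle] at hs
    subst hs
    exact refTail_eq hT hq (by omega) (by omega) t
  -- Here s = k₁, so s + 2m + 1 = q and s + 2h + 1 = k₁ + k₂ - q: the reference pair is the dual
  -- one.
  · have hfm : ⌊2 * m + 1⌋₊ = q - k₁ := by
      rw [hm, abs_of_nonneg (by simpa using hle),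
        show 2 * ((((q : ℝ) - k₁) - 1) / 2) + 1 = ((q - k₁ : ℕ) : ℝ) by
          rw [Nat.cast_sub hle]; ring, Nat.floor_natCast]
    rw [min_eq_right hle] at hs
    subst hs
    rw [refTail_eq hT hk₁ (k₁ := q) (k₂ := s + (k₂ - q)) (by omega) (by omega) t]
    exact (wishartPair_duality hT hq hk₁ hqk (by omega) t).symm

/-- A spectral statistic of independent `W_q(k₁, I)` and `W_q(k₂, I)` matrices exceeds its critical
value with probability `α`. -/
theorem wishartPair_critical_le (hT : IsSpectralStat T) {q k₁ k₂ s : ℕ} (hq : 0 < q) (hk₁ : 0 < k₁)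
    (hqk : q ≤ k₂) (hs : s = min q k₁) {m h : ℝ} (hm : m = (|(q : ℝ) - k₁| - 1) / 2)
    (hh : h = ((k₂ : ℝ) - q - 1) / 2) {α : ℝ} (hα0 : 0 < α) (hα1 : α < 1) :
    wishartPair k₁ k₂ q {w | critical T α s m h ≤ onGood T w} = ENNReal.ofReal α := by
  rw [critical]
  simp_rw [refTail_eq_wishartPair hT hq hk₁ hqk hs hm hh]
  exact measure_sSup_le_eq (hT.measurable_onGood hq) (wishartPair_atomless hT hq hk₁ hqk) hα0 hα1

end

/-! ### A single simple linear model -/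

section SingleModel

variable {k : ℕ} {x : Fin k → ℝ}

/-- The projection onto the residuals. -/
noncomputable def residProj (x : Fin k → ℝ) : Matrix (Fin k) (Fin k) ℝ :=
  1 - design x * pinv (design x)

/-- The coefficients of the estimator of `a α + b β`. -/
noncomputable def contrast (x : Fin k → ℝ) (a b : ℝ) : Fin k → ℝ :=
  ![a, b] ᵥ* pinv (design x)

theorem posDef_gram_design (hx : (design x).rank = 2) : ((design x)ᵀ * design x).PosDef :=
  posDef_transpose_mul_self_of_rank hx

theorem isUnit_gram_design (hx : (design x).rank = 2) : IsUnit ((design x)ᵀ * design x).det :=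
  isUnit_iff_ne_zero.2 (posDef_gram_design hx).det_pos.ne'

theorem design_mul_pinv (x : Fin k → ℝ) : design x * pinv (design x) = hat (design x) := by
  rw [pinv, hat, Matrix.mul_assoc]

theorem pinv_mul_design (hx : (design x).rank = 2) : pinv (design x) * design x = 1 := by
  rw [pinv, Matrix.mul_assoc, nonsing_inv_mul _ (isUnit_gram_design hx)]

theorem transpose_residProj (x : Fin k → ℝ) : (residProj x)ᵀ = residProj x := by
  rw [residProj, design_mul_pinv, transpose_sub, transpose_one, transpose_hat]

theorem residProj_mul_self (hx : (design x).rank = 2) :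
    residProj x * residProj x = residProj x := by
  rw [residProj, design_mul_pinv, Matrix.sub_mul, Matrix.one_mul, Matrix.mul_sub,
    hat_mul_self (isUnit_gram_design hx), Matrix.mul_one, sub_self, sub_zero]

theorem trace_residProj (hx : (design x).rank = 2) : (residProj x).trace = k - 2 := by
  rw [residProj, design_mul_pinv, trace_sub, trace_hat (isUnit_gram_design hx), trace_one]
  simp

theorem residProj_mul_design (hx : (design x).rank = 2) : residProj x * design x = 0 := by
  rw [residProj, Matrix.sub_mul, Matrix.mul_assoc, pinv_mul_design hx, Matrix.one_mul,
    Matrix.mul_one, sub_self]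

theorem contrast_vecMul_design (hx : (design x).rank = 2) (a b : ℝ) :
    contrast x a b ᵥ* design x = ![a, b] := by
  rw [contrast, vecMul_vecMul, pinv_mul_design hx, vecMul_one]

/-- The contrast vector lies in the column space of the design. This is the source of the
independence of Z and S_E. -/
theorem residProj_mulVec_contrast (hx : (design x).rank = 2) (a b : ℝ) :
    residProj x *ᵥ contrast x a b = 0 := by
  have : contrast x a b = design x *ᵥ (((design x)ᵀ * design x)⁻¹ *ᵥ ![a, b]) := by
    rw [contrast, pinv, ← mulVec_transpose, transpose_mul, transpose_transpose,
      transpose_nonsing_inv, transpose_mul, transpose_transpose, mulVec_mulVec]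
  rw [this, mulVec_mulVec, residProj_mul_design hx, zero_mulVec]

theorem contrast_dotProduct_self (hx : (design x).rank = 2) (a b : ℝ) :
    contrast x a b ⬝ᵥ contrast x a b = ![a, b] ⬝ᵥ ((design x)ᵀ * design x)⁻¹ *ᵥ ![a, b] := by
  have h : pinv (design x) * (pinv (design x))ᵀ = ((design x)ᵀ * design x)⁻¹ := by
    rw [pinv, transpose_mul, transpose_transpose, transpose_nonsing_inv, transpose_mul,
      transpose_transpose, Matrix.mul_assoc, ← Matrix.mul_assoc (design x)ᵀ,
      mul_nonsing_inv _ (isUnit_gram_design hx), Matrix.mul_one]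
  rw [contrast, ← dotProduct_mulVec, ← mulVec_transpose, mulVec_mulVec, h]

theorem contrast_dotProduct_self_pos (hx : (design x).rank = 2) {a b : ℝ} (hab : a ≠ 0 ∨ b ≠ 0) :
    0 < contrast x a b ⬝ᵥ contrast x a b := by
  rw [contrast_dotProduct_self hx]
  have hc : ![a, b] ≠ 0 := fun h => by
    have h0 := congrFun h 0
    have h1 := congrFun h 1
    simp at h0 h1
    tauto
  simpa using (posDef_gram_design hx).inv.dotProduct_mulVec_pos hc

theorem gram_design (x : Fin k → ℝ) :
    (design x)ᵀ * design x = !![(k : ℝ), ∑ i, x i; ∑ i, x i, ∑ i, x i ^ 2] := by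
  ext i j
  fin_cases i <;> fin_cases j <;> simp [design, mul_apply, sq]

theorem mul_normSq_centring (x : Fin k → ℝ) :
    (k : ℝ) * normSq (centring k *ᵥ x) = k * ∑ i, x i ^ 2 - (∑ i, x i) ^ 2 := by
  have h : ∀ i, (centring k *ᵥ x) i = x i - (k : ℝ)⁻¹ * ∑ j, x j := by
    intro i
    rw [centring, sub_mulVec, one_mulVec, smul_mulVec, Pi.sub_apply, Pi.smul_apply, smul_eq_mul]
    congr 2
    simp [mulVec, dotProduct]
  rcases Nat.eq_zero_or_pos k with rfl | hk
  · simp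
  have hk' : (k : ℝ) ≠ 0 := by positivity
  have h2 : ∀ i, (x i - (k : ℝ)⁻¹ * ∑ j, x j) ^ 2 =
      x i ^ 2 - 2 * (k : ℝ)⁻¹ * (∑ j, x j) * x i + ((k : ℝ)⁻¹ * ∑ j, x j) ^ 2 := fun i => by ring
  rw [normSq]
  simp_rw [h, h2]
  rw [Finset.sum_add_distrib, Finset.sum_sub_distrib, ← Finset.mul_sum, Finset.sum_const,
    Finset.card_univ, Fintype.card_fin, nsmul_eq_mul]
  field_simp
  ring

theorem normSq_smul_sub (x : Fin k → ℝ) (a b : ℝ) :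
    normSq (fun i => a * x i - b) = a ^ 2 * ∑ i, x i ^ 2 - 2 * a * b * ∑ i, x i + k * b ^ 2 := by
  have h : ∀ i, (a * x i - b) ^ 2 = a ^ 2 * x i ^ 2 - 2 * a * b * x i + b ^ 2 := fun i => by ring
  rw [normSq]
  simp_rw [h]
  rw [Finset.sum_add_distrib, Finset.sum_sub_distrib, ← Finset.mul_sum, ← Finset.mul_sum,
    Finset.sum_const, Finset.card_univ, Fintype.card_fin, nsmul_eq_mul]

/-- The variance factor of aα̂ + bβ̂, by the explicit inverse of the 2 × 2 Gram matrix. It is the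
reciprocal of the weight d_rr, which explains the formula for the latter. -/
theorem contrast_dotProduct_self_eq (hx : (design x).rank = 2) (a b : ℝ) :
    contrast x a b ⬝ᵥ contrast x a b =
      normSq (fun i => a * x i - b) / (k * normSq (centring k *ᵥ x)) := by
  rw [contrast_dotProduct_self hx, gram_design, inv_def, adjugate_fin_two, det_fin_two,
    mul_normSq_centring, normSq_smul_sub, Ring.inverse_eq_inv']
  simp [mulVec, dotProduct, Fin.sum_univ_two]
  ring

end SingleModel

section Models

variable {R : ℕ} {n : Fin R → ℕ} {x : (r : Fin R) → Fin (n r) → ℝ}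

theorem weight_mul_contrast (hx : ∀ r, (design (x r)).rank = 2) {a b : ℝ} (hab : a ≠ 0 ∨ b ≠ 0)
    (r : Fin R) : weight x a b r * (contrast (x r) a b ⬝ᵥ contrast (x r) a b) = 1 := by
  have h := contrast_dotProduct_self_pos (hx r) hab
  rw [contrast_dotProduct_self_eq (hx r)] at h ⊢
  rw [weight, div_mul_div_comm, mul_comm, div_self]
  -- If either factor vanished, the quotient in `h` would be 0 (also when it is the denominator),
  -- against its positivity.
  intro h0
  rcases mul_eq_zero.1 h0 with h1 | h1 <;> simp [h1] at h

theorem weight_pos (hx : ∀ r, (design (x r)).rank = 2) {a b : ℝ} (hab : a ≠ 0 ∨ b ≠ 0)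
    (r : Fin R) : 0 < weight x a b r := by
  have h := contrast_dotProduct_self_pos (hx r) hab
  by_contra! hc
  nlinarith [weight_mul_contrast hx hab r]

/-! ### Stacking the models -/

/-- The matrix of all the observations. -/
def stack {q : ℕ} (Y : Data n q) : Matrix ((r : Fin R) × Fin (n r)) (Fin q) ℝ :=
  Matrix.of fun p => Y p.1 p.2

theorem transpose_stack_mul_stack {q q' : ℕ} (Y : Data n q) (Z : Data n q') :
    (stack Y)ᵀ * stack Z = ∑ r, (Y r)ᵀ * Z r := by
  ext i j
  rw [mul_apply, Fintype.sum_sigma, Matrix.sum_apply]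
  rfl

theorem blockDiagonal'_mul_stack {q : ℕ} (M : (r : Fin R) → Matrix (Fin (n r)) (Fin (n r)) ℝ)
    (Y : Data n q) : blockDiagonal' M * stack Y = stack fun r => M r * Y r := by
  ext ⟨r, i⟩ j
  rw [mul_apply, Fintype.sum_sigma, Finset.sum_eq_single r]
  · simp only [blockDiagonal'_apply_eq]
    rfl
  · intro r' _ hr'
    refine Finset.sum_eq_zero fun i' _ => ?_
    rw [blockDiagonal'_apply_ne _ _ _ hr'.symm, zero_mul]
  · simp

/-- The projection onto the residuals of all the models. -/
noncomputable def projE (x : (r : Fin R) → Fin (n r) → ℝ) :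
    Matrix ((r : Fin R) × Fin (n r)) ((r : Fin R) × Fin (n r)) ℝ :=
  blockDiagonal' fun r => residProj (x r)

/-- The blocks of the matrix mapping the observations to `D^{1/2} Z`. -/
noncomputable def scaledContrast (x : (r : Fin R) → Fin (n r) → ℝ) (a b : ℝ) : Data n R :=
  fun r => Matrix.of fun i r' => if r' = r then √(weight x a b r) * contrast (x r) a b i else 0

/-- The matrix mapping the observations to `D^{1/2} Z`. -/
noncomputable def mapZ (x : (r : Fin R) → Fin (n r) → ℝ) (a b : ℝ) :
    Matrix (Fin R) ((r : Fin R) × Fin (n r)) ℝ :=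
  (stack (scaledContrast x a b))ᵀ

/-- The weighted centring projection. -/
noncomputable def weightedCentring (x : (r : Fin R) → Fin (n r) → ℝ) (a b : ℝ) :
    Matrix (Fin R) (Fin R) ℝ :=
  1 - (∑ r, weight x a b r)⁻¹ •
    (sqrtD x a b * (Matrix.of fun _ _ => (1 : ℝ)) * sqrtD x a b)

/-- The projection onto the space of the hypothesis. -/
noncomputable def projH (x : (r : Fin R) → Fin (n r) → ℝ) (a b : ℝ) :
    Matrix ((r : Fin R) × Fin (n r)) ((r : Fin R) × Fin (n r)) ℝ :=
  (mapZ x a b)ᵀ * weightedCentring x a b * mapZ x a b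

/-! ### S_H and S_E as quadratic forms in orthogonal projections -/

theorem mapZ_mul_stack_apply {q : ℕ} (x : (r : Fin R) → Fin (n r) → ℝ) (a b : ℝ) (Y : Data n q)
    (r : Fin R) (j : Fin q) :
    (mapZ x a b * stack Y) r j = √(weight x a b r) * (contrast (x r) a b ᵥ* Y r) j := by
  rw [mapZ, transpose_stack_mul_stack, Matrix.sum_apply, Finset.sum_eq_single r]
  · simp [mul_apply, scaledContrast, vecMul, dotProduct, Finset.mul_sum, mul_assoc]
  · intro r' _ hr'
    simp [mul_apply, scaledContrast, hr'.symm]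
  · simp

theorem sqrtD_mul_matZ {q : ℕ} (x : (r : Fin R) → Fin (n r) → ℝ) (a b : ℝ) (Y : Data n q) :
    sqrtD x a b * matZ x a b Y = mapZ x a b * stack Y := by
  ext r j
  rw [mapZ_mul_stack_apply, sqrtD, diagonal_mul, contrast, vecMul_vecMul]
  simp [matZ, estimator, vecMul, dotProduct, Fin.sum_univ_two]

theorem matSH_eq {q : ℕ} (x : (r : Fin R) → Fin (n r) → ℝ) (a b : ℝ) (Y : Data n q) :
    matSH x a b Y = (stack Y)ᵀ * projH x a b * stack Y := by
  rw [matSH, sqrtD_mul_matZ, projH, weightedCentring, transpose_mul]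
  simp only [Matrix.mul_assoc]

theorem matSE_eq {q : ℕ} (x : (r : Fin R) → Fin (n r) → ℝ) (Y : Data n q) :
    matSE x Y = (stack Y)ᵀ * projE x * stack Y := by
  rw [Matrix.mul_assoc, projE, blockDiagonal'_mul_stack, transpose_stack_mul_stack, matSE]
  simp only [residProj, Matrix.mul_assoc]

/-- Different rows live on different models, and d_rr normalises each row to length 1. -/
theorem mapZ_mul_transpose (hx : ∀ r, (design (x r)).rank = 2) {a b : ℝ} (hab : a ≠ 0 ∨ b ≠ 0) :
    mapZ x a b * (mapZ x a b)ᵀ = 1 := by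
  ext r r'
  rw [mapZ, transpose_transpose, ← mapZ, mapZ_mul_stack_apply]
  have h := weight_mul_contrast hx hab r
  have hs := Real.mul_self_sqrt (weight_pos hx hab r).le
  by_cases hrr : r' = r
  · subst hrr
    rw [one_apply_eq, ← h, ← hs]
    simp only [vecMul, dotProduct, scaledContrast, of_apply, if_true, Finset.mul_sum]
    rw [Real.sqrt_mul_self (Real.sqrt_nonneg _)]
    exact Finset.sum_congr rfl fun i _ => by ring
  · rw [one_apply_ne (Ne.symm hrr)]
    simp [vecMul, dotProduct, scaledContrast, hrr]

theorem projE_mul_transpose_mapZ (hx : ∀ r, (design (x r)).rank = 2) (a b : ℝ) :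
    projE x * (mapZ x a b)ᵀ = 0 := by
  rw [mapZ, transpose_transpose, projE, blockDiagonal'_mul_stack]
  ext ⟨r, i⟩ r'
  change (residProj (x r) * scaledContrast x a b r) i r' = 0
  have h := congrFun (residProj_mulVec_contrast (hx r) a b) i
  rw [mul_apply]
  by_cases hrr : r' = r
  · simp only [mulVec, dotProduct, Pi.zero_apply] at h
    simp only [scaledContrast, of_apply, hrr, if_true]
    rw [← mul_zero √(weight x a b r), ← h, Finset.mul_sum]
    exact Finset.sum_congr rfl fun j _ => by ring
  · simp [scaledContrast, hrr]

theorem transpose_projE (x : (r : Fin R) → Fin (n r) → ℝ) : (projE x)ᵀ = projE x := by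
  rw [projE, blockDiagonal'_transpose]
  simp only [transpose_residProj]

theorem projE_mul_self (hx : ∀ r, (design (x r)).rank = 2) : projE x * projE x = projE x := by
  rw [projE, ← blockDiagonal'_mul]
  simp only [residProj_mul_self (hx _)]

theorem trace_projE (hx : ∀ r, (design (x r)).rank = 2) :
    (projE x).trace = ((∑ r, n r : ℕ) : ℝ) - 2 * R := by
  rw [projE, trace_blockDiagonal']
  simp only [trace_residProj (hx _), Finset.sum_sub_distrib]
  simp [mul_comm]

theorem sqrtD_ones_apply (x : (r : Fin R) → Fin (n r) → ℝ) (a b : ℝ) (r r' : Fin R) :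
    (sqrtD x a b * (Matrix.of fun _ _ => (1 : ℝ) : Matrix (Fin R) (Fin R) ℝ) * sqrtD x a b) r r' =
      √(weight x a b r) * √(weight x a b r') := by
  rw [sqrtD, mul_diagonal, diagonal_mul]
  simp

theorem transpose_weightedCentring (x : (r : Fin R) → Fin (n r) → ℝ) (a b : ℝ) :
    (weightedCentring x a b)ᵀ = weightedCentring x a b := by
  rw [weightedCentring, transpose_sub, transpose_one, transpose_smul]
  congr 2
  ext r r'
  rw [transpose_apply, sqrtD_ones_apply, sqrtD_ones_apply, mul_comm]

theorem sum_weight_pos (hR : 2 ≤ R) (hx : ∀ r, (design (x r)).rank = 2) {a b : ℝ}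
    (hab : a ≠ 0 ∨ b ≠ 0) : 0 < ∑ r, weight x a b r :=
  Finset.sum_pos (fun r _ => weight_pos hx hab r) ⟨⟨0, by omega⟩, Finset.mem_univ _⟩

/-- With d the vector of the √d_rr, the matrix is I - dd'/(d'd). That it kills d yields both its
idempotence and the vanishing of the mean of S_H's quadratic form under the null hypothesis. -/
theorem weightedCentring_mulVec_sqrt (hR : 2 ≤ R) (hx : ∀ r, (design (x r)).rank = 2) {a b : ℝ}
    (hab : a ≠ 0 ∨ b ≠ 0) : weightedCentring x a b *ᵥ (fun r => √(weight x a b r)) = 0 := by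
  have hs := (sum_weight_pos hR hx hab).ne'
  ext r
  rw [weightedCentring, sub_mulVec, one_mulVec, smul_mulVec, Pi.sub_apply, Pi.smul_apply,
    smul_eq_mul]
  simp only [mulVec, dotProduct, sqrtD_ones_apply]
  simp only [mul_assoc, Real.mul_self_sqrt (weight_pos hx hab _).le]
  rw [← Finset.mul_sum]
  simp only [Pi.zero_apply]
  field_simp
  ring

theorem weightedCentring_mul_self (hR : 2 ≤ R) (hx : ∀ r, (design (x r)).rank = 2) {a b : ℝ}
    (hab : a ≠ 0 ∨ b ≠ 0) :
    weightedCentring x a b * weightedCentring x a b = weightedCentring x a b := by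
  have h : weightedCentring x a b *
      (sqrtD x a b * (Matrix.of fun _ _ => (1 : ℝ)) * sqrtD x a b) = 0 := by
    ext r r'
    have := congrFun (weightedCentring_mulVec_sqrt hR hx hab) r
    simp only [mulVec, dotProduct] at this
    rw [mul_apply]
    simp only [sqrtD_ones_apply, ← mul_assoc]
    rw [← Finset.sum_mul, this]
    simp
  nth_rewrite 2 [weightedCentring]
  rw [Matrix.mul_sub, Matrix.mul_one, Matrix.mul_smul, h, smul_zero, sub_zero]

theorem trace_weightedCentring (hR : 2 ≤ R) (hx : ∀ r, (design (x r)).rank = 2) {a b : ℝ}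
    (hab : a ≠ 0 ∨ b ≠ 0) : (weightedCentring x a b).trace = ((R - 1 : ℕ) : ℝ) := by
  rw [weightedCentring, trace_sub, trace_one, trace_smul, trace, Fintype.card_fin]
  simp only [diag_apply, sqrtD_ones_apply, Real.mul_self_sqrt (weight_pos hx hab _).le]
  rw [smul_eq_mul, inv_mul_cancel₀ (sum_weight_pos hR hx hab).ne', Nat.cast_sub (by omega),
    Nat.cast_one]

theorem transpose_projH (x : (r : Fin R) → Fin (n r) → ℝ) (a b : ℝ) :
    (projH x a b)ᵀ = projH x a b := by
  rw [projH, transpose_mul, transpose_mul, transpose_transpose, transpose_weightedCentring,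
    Matrix.mul_assoc]

theorem projH_mul_self (hR : 2 ≤ R) (hx : ∀ r, (design (x r)).rank = 2) {a b : ℝ}
    (hab : a ≠ 0 ∨ b ≠ 0) : projH x a b * projH x a b = projH x a b := by
  calc projH x a b * projH x a b = (mapZ x a b)ᵀ * weightedCentring x a b *
        (mapZ x a b * (mapZ x a b)ᵀ) * weightedCentring x a b * mapZ x a b := by
        simp only [projH, Matrix.mul_assoc]
    _ = (mapZ x a b)ᵀ * (weightedCentring x a b * weightedCentring x a b) * mapZ x a b := by
        rw [mapZ_mul_transpose hx hab, Matrix.mul_one]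
        simp only [Matrix.mul_assoc]
    _ = _ := by rw [weightedCentring_mul_self hR hx hab, projH]

theorem trace_projH (hR : 2 ≤ R) (hx : ∀ r, (design (x r)).rank = 2) {a b : ℝ}
    (hab : a ≠ 0 ∨ b ≠ 0) : (projH x a b).trace = ((R - 1 : ℕ) : ℝ) := by
  rw [projH, trace_mul_comm, ← Matrix.mul_assoc, mapZ_mul_transpose hx hab, Matrix.one_mul,
    trace_weightedCentring hR hx hab]

theorem projH_mul_projE (hx : ∀ r, (design (x r)).rank = 2) (a b : ℝ) :
    projH x a b * projE x = 0 := by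
  have h := congrArg transpose (projE_mul_transpose_mapZ hx a b)
  rw [transpose_mul, transpose_transpose, transpose_projE, transpose_zero] at h
  rw [projH, Matrix.mul_assoc, h, Matrix.mul_zero]

theorem projE_mul_stack_mean {q : ℕ} (hx : ∀ r, (design (x r)).rank = 2) (B : Params R q) :
    projE x * stack (fun r => design (x r) * B r) = 0 := by
  rw [projE, blockDiagonal'_mul_stack]
  simp only [← Matrix.mul_assoc, residProj_mul_design (hx _), Matrix.zero_mul]
  rfl

/-- Under the null hypothesis row r of the mean of D^{1/2}Z is √d_rr times a vector common to all r,
so each column is a multiple of the vector killed by the weighted centring. -/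
theorem projH_mul_stack_mean {q : ℕ} (hR : 2 ≤ R) (hx : ∀ r, (design (x r)).rank = 2) {a b : ℝ}
    (hab : a ≠ 0 ∨ b ≠ 0) {B : Params R q} (hB : NullHyp a b B) :
    projH x a b * stack (fun r => design (x r) * B r) = 0 := by
  have h : weightedCentring x a b * (mapZ x a b * stack (fun r => design (x r) * B r)) = 0 := by
    ext r j
    have h0 := congrFun (weightedCentring_mulVec_sqrt hR hx hab) r
    simp only [mulVec, dotProduct] at h0
    rw [mul_apply]
    have h1 : ∀ r', (contrast (x r') a b ᵥ* (design (x r') * B r')) j =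
        (a • B r 0 + b • B r 1) j := by
      intro r'
      rw [← vecMul_vecMul, contrast_vecMul_design (hx r'), hB r r']
      simp [vecMul, dotProduct, Fin.sum_univ_two]
    simp only [mapZ_mul_stack_apply, h1, ← mul_assoc]
    rw [← Finset.sum_mul, h0]
    simp
  rw [projH, Matrix.mul_assoc, Matrix.mul_assoc, h, Matrix.mul_zero]

theorem transpose_mul_mul_add_of_mul_eq_zero {ι : Type*} [Fintype ι] {q : ℕ} {P : Matrix ι ι ℝ}
    (hP : Pᵀ = P) {A E : Matrix ι (Fin q) ℝ} (h : P * A = 0) :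
    (A + E)ᵀ * P * (A + E) = Eᵀ * P * E := by
  have h' : Aᵀ * P = 0 := by
    rw [← hP, ← transpose_mul, h, transpose_zero]
  rw [transpose_add, Matrix.add_mul, h', zero_add, Matrix.mul_add, Matrix.mul_assoc, h,
    Matrix.mul_zero, zero_add]

end Models

/-! ### The univariate `F` statistics -/

/-- Pythagoras: the residual of least squares is orthogonal to the column space of the design. -/
theorem dotProduct_self_sub_design {k : ℕ} {x : Fin k → ℝ} (hx : (design x).rank = 2)
    (y : Fin k → ℝ) (γ : Fin 2 → ℝ) :
    ∑ i, (y i - (γ 0 + γ 1 * x i)) ^ 2 = y ⬝ᵥ residProj x *ᵥ y +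
      (design x *ᵥ (γ - pinv (design x) *ᵥ y)) ⬝ᵥ (design x *ᵥ (γ - pinv (design x) *ᵥ y)) := by
  set δ := γ - pinv (design x) *ᵥ y with hδ
  have h1 : ∀ i, y i - (γ 0 + γ 1 * x i) = (residProj x *ᵥ y - design x *ᵥ δ) i := by
    intro i
    rw [hδ, mulVec_sub, mulVec_mulVec, residProj, sub_mulVec, one_mulVec, sub_sub_sub_cancel_right]
    simp [mulVec, dotProduct, design, Fin.sum_univ_two, mul_comm]
  have h2 : residProj x *ᵥ y ⬝ᵥ design x *ᵥ δ = 0 := by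
    rw [← transpose_residProj, mulVec_transpose, ← dotProduct_mulVec, mulVec_mulVec,
      residProj_mul_design hx, zero_mulVec, dotProduct_zero]
  have h3 : residProj x *ᵥ y ⬝ᵥ residProj x *ᵥ y = y ⬝ᵥ residProj x *ᵥ y := by
    nth_rewrite 1 [← transpose_residProj]
    rw [mulVec_transpose, ← dotProduct_mulVec, mulVec_mulVec, residProj_mul_self hx]
  have h4 : ∑ i, (y i - (γ 0 + γ 1 * x i)) ^ 2 =
      (residProj x *ᵥ y - design x *ᵥ δ) ⬝ᵥ (residProj x *ᵥ y - design x *ᵥ δ) := by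
    simp only [h1, dotProduct, sq]
  rw [h4, sub_dotProduct, dotProduct_sub, dotProduct_sub, h2, dotProduct_comm (design x *ᵥ δ), h2, h3]
  ring

section

variable {R : ℕ} {n : Fin R → ℕ} {x : (r : Fin R) → Fin (n r) → ℝ}

theorem residSq_eq (hx : ∀ r, (design (x r)).rank = 2) (y : (r : Fin R) → Fin (n r) → ℝ)
    (γ : Fin R → Fin 2 → ℝ) :
    residSq x y γ = ∑ r, y r ⬝ᵥ residProj (x r) *ᵥ y r +
      ∑ r, (design (x r) *ᵥ (γ r - pinv (design (x r)) *ᵥ y r)) ⬝ᵥ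
        (design (x r) *ᵥ (γ r - pinv (design (x r)) *ᵥ y r)) := by
  rw [residSq, ← Finset.sum_add_distrib]
  exact Finset.sum_congr rfl fun r _ => dotProduct_self_sub_design (hx r) _ _

theorem dotProduct_self_nonneg_real {k : ℕ} (v : Fin k → ℝ) : 0 ≤ v ⬝ᵥ v :=
  Finset.sum_nonneg fun _ _ => mul_self_nonneg _

theorem residSq_nonneg (y : (r : Fin R) → Fin (n r) → ℝ) (γ : Fin R → Fin 2 → ℝ) :
    0 ≤ residSq x y γ :=
  Finset.sum_nonneg fun _ _ => Finset.sum_nonneg fun _ _ => sq_nonneg _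

theorem rssFull_eq (hx : ∀ r, (design (x r)).rank = 2) (y : (r : Fin R) → Fin (n r) → ℝ) :
    rssFull x y = ∑ r, y r ⬝ᵥ residProj (x r) *ᵥ y r := by
  refine le_antisymm ?_ (le_ciInf fun γ => ?_)
  · refine (ciInf_le ⟨0, ?_⟩ fun r => pinv (design (x r)) *ᵥ y r).trans ?_
    · rintro _ ⟨γ, rfl⟩
      exact residSq_nonneg y γ
    · rw [residSq_eq hx]
      simp
  · rw [residSq_eq hx]
    exact le_add_of_nonneg_right (Finset.sum_nonneg fun r _ => dotProduct_self_nonneg_real _)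

theorem contrast_dotProduct_design (hx : ∀ r, (design (x r)).rank = 2) (a b : ℝ)
    (y : (r : Fin R) → Fin (n r) → ℝ) (γ : Fin R → Fin 2 → ℝ) (r : Fin R) :
    contrast (x r) a b ⬝ᵥ (design (x r) *ᵥ (γ r - pinv (design (x r)) *ᵥ y r)) =
      a * γ r 0 + b * γ r 1 - contrast (x r) a b ⬝ᵥ y r := by
  rw [dotProduct_mulVec, contrast_vecMul_design (hx r), dotProduct_sub, contrast,
    ← dotProduct_mulVec]
  simp [dotProduct, Fin.sum_univ_two]

theorem weight_mul_sq_le (hx : ∀ r, (design (x r)).rank = 2) {a b : ℝ} (hab : a ≠ 0 ∨ b ≠ 0)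
    (r : Fin R) (v : Fin (n r) → ℝ) :
    weight x a b r * (contrast (x r) a b ⬝ᵥ v) ^ 2 ≤ v ⬝ᵥ v := by
  have hcs : (contrast (x r) a b ⬝ᵥ v) ^ 2 ≤
      (contrast (x r) a b ⬝ᵥ contrast (x r) a b) * (v ⬝ᵥ v) := by
    simpa [dotProduct, sq] using Finset.sum_mul_sq_le_sq_mul_sq Finset.univ (contrast (x r) a b) v
  calc weight x a b r * (contrast (x r) a b ⬝ᵥ v) ^ 2
      ≤ weight x a b r * ((contrast (x r) a b ⬝ᵥ contrast (x r) a b) * (v ⬝ᵥ v)) :=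
        mul_le_mul_of_nonneg_left hcs (weight_pos hx hab r).le
    _ = v ⬝ᵥ v := by rw [← mul_assoc, weight_mul_contrast hx hab, one_mul]

theorem sum_mul_sub_sq {ι : Type*} [Fintype ι] (d z : ι → ℝ) (hd : 0 < ∑ i, d i) (u : ℝ) :
    ∑ i, d i * (u - z i) ^ 2 = (∑ i, d i * z i ^ 2 - (∑ i, d i * z i) ^ 2 / ∑ i, d i) +
      (∑ i, d i) * (u - (∑ i, d i * z i) / ∑ i, d i) ^ 2 := by
  have h : ∀ i, d i * (u - z i) ^ 2 = u ^ 2 * d i - 2 * u * (d i * z i) + d i * z i ^ 2 :=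
    fun i => by ring
  simp_rw [h]
  rw [Finset.sum_add_distrib, Finset.sum_sub_distrib, ← Finset.mul_sum, ← Finset.mul_sum]
  field_simp
  ring

/-- Let u be the common value of aγ_r0 + bγ_r1 and z_r its unrestricted estimate. The constraint
prescribes the product u - z_r of the contrast vector with the shift of the fitted values, and by
Cauchy–Schwarz such a shift costs at least d_rr(u - z_r)². Minimising over u leaves the weighted sum
of squares of the z_r about their weighted mean. -/
theorem rssNull_eq (hR : 2 ≤ R) (hx : ∀ r, (design (x r)).rank = 2) {a b : ℝ}
    (hab : a ≠ 0 ∨ b ≠ 0) (y : (r : Fin R) → Fin (n r) → ℝ) :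
    rssNull x y a b = rssFull x y +
      (∑ r, weight x a b r * (contrast (x r) a b ⬝ᵥ y r) ^ 2 -
        (∑ r, weight x a b r * (contrast (x r) a b ⬝ᵥ y r)) ^ 2 / ∑ r, weight x a b r) := by
  have hd := sum_weight_pos hR hx hab
  rw [rssFull_eq hx]
  set u := (∑ r, weight x a b r * (contrast (x r) a b ⬝ᵥ y r)) / ∑ r, weight x a b r with hu
  -- The equality case of Cauchy–Schwarz: the fitted values move along the contrast vector, by the
  -- multiple that brings z_r to the weighted mean `u`.
  set γ : Fin R → Fin 2 → ℝ := fun r => pinv (design (x r)) *ᵥ y r +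
    ((u - contrast (x r) a b ⬝ᵥ y r) * weight x a b r) •
      (pinv (design (x r)) *ᵥ contrast (x r) a b) with hγ
  have hXc : ∀ r, design (x r) *ᵥ (pinv (design (x r)) *ᵥ contrast (x r) a b) =
      contrast (x r) a b := by
    intro r
    have := residProj_mulVec_contrast (hx r) a b
    rw [residProj, sub_mulVec, one_mulVec, sub_eq_zero] at this
    rw [mulVec_mulVec, ← this]
  have hδ : ∀ r, design (x r) *ᵥ (γ r - pinv (design (x r)) *ᵥ y r) =
      ((u - contrast (x r) a b ⬝ᵥ y r) * weight x a b r) • contrast (x r) a b := by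
    intro r
    rw [hγ]
    simp only [add_sub_cancel_left]
    rw [mulVec_smul, hXc]
  have hcon : ∀ r, a * γ r 0 + b * γ r 1 = u := by
    intro r
    have h1 := contrast_dotProduct_design hx a b y γ r
    rw [hδ, dotProduct_smul, smul_eq_mul, mul_assoc, weight_mul_contrast hx hab, mul_one] at h1
    linarith
  have hval : residSq x y γ = ∑ r, y r ⬝ᵥ residProj (x r) *ᵥ y r +
      ∑ r, weight x a b r * (u - contrast (x r) a b ⬝ᵥ y r) ^ 2 := by
    rw [residSq_eq hx]
    congr 1
    refine Finset.sum_congr rfl fun r _ => ?_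
    rw [hδ, dotProduct_smul, smul_dotProduct, smul_eq_mul, smul_eq_mul]
    calc _ = (u - contrast (x r) a b ⬝ᵥ y r) ^ 2 * weight x a b r *
          (weight x a b r * (contrast (x r) a b ⬝ᵥ contrast (x r) a b)) := by ring
      _ = _ := by rw [weight_mul_contrast hx hab]; ring
  rw [sum_mul_sub_sq _ _ hd, hu, sub_self] at hval
  apply le_antisymm
  · refine (ciInf_le ⟨0, ?_⟩ ⟨γ, fun r r' => by rw [hcon, hcon]⟩).trans (le_of_eq ?_)
    · rintro _ ⟨γ, rfl⟩
      exact residSq_nonneg y _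
    · rw [hval]
      ring
  · have : Nonempty {γ : Fin R → Fin 2 → ℝ //
        ∀ r r' : Fin R, a * γ r 0 + b * γ r 1 = a * γ r' 0 + b * γ r' 1} :=
      ⟨⟨γ, fun r r' => by rw [hcon, hcon]⟩⟩
    refine le_ciInf fun γ' => ?_
    obtain ⟨γ', hγ'⟩ := γ'
    rw [residSq_eq hx]
    refine add_le_add le_rfl ?_
    -- The common value of a competitor `γ'` is read off at an arbitrary index.
    let r₀ : Fin R := ⟨0, by omega⟩
    have h1 := sum_mul_sub_sq (weight x a b) (fun r => contrast (x r) a b ⬝ᵥ y r) hd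
      (a * γ' r₀ 0 + b * γ' r₀ 1)
    have h2 : 0 ≤ (∑ r, weight x a b r) * (a * γ' r₀ 0 + b * γ' r₀ 1 -
      (∑ r, weight x a b r * (contrast (x r) a b ⬝ᵥ y r)) / ∑ r, weight x a b r) ^ 2 := by
      positivity
    refine le_trans (by linarith) (h1.symm.le.trans (Finset.sum_le_sum fun r _ => ?_))
    rw [hγ' r₀ r, ← contrast_dotProduct_design hx]
    exact weight_mul_sq_le hx hab r _

theorem dotProduct_transpose_mul_mul {ι : Type*} [Fintype ι] {q : ℕ} (A : Matrix ι (Fin q) ℝ)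
    (P : Matrix ι ι ℝ) (c : Fin q → ℝ) :
    c ⬝ᵥ (Aᵀ * P * A) *ᵥ c = (A *ᵥ c) ⬝ᵥ P *ᵥ (A *ᵥ c) := by
  rw [← mulVec_mulVec, ← mulVec_mulVec, dotProduct_mulVec, vecMul_transpose]

theorem rssFull_mulVec {q : ℕ} (hx : ∀ r, (design (x r)).rank = 2) (Y : Data n q) (c : Fin q → ℝ) :
    rssFull x (fun r => Y r *ᵥ c) = c ⬝ᵥ matSE x Y *ᵥ c := by
  rw [rssFull_eq hx, matSE, sum_mulVec, dotProduct_sum]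
  refine Finset.sum_congr rfl fun r _ => ?_
  rw [← residProj, dotProduct_transpose_mul_mul]

theorem rssNull_sub_rssFull_mulVec {q : ℕ} (hR : 2 ≤ R) (hx : ∀ r, (design (x r)).rank = 2)
    {a b : ℝ} (hab : a ≠ 0 ∨ b ≠ 0) (Y : Data n q) (c : Fin q → ℝ) :
    rssNull x (fun r => Y r *ᵥ c) a b - rssFull x (fun r => Y r *ᵥ c) =
      c ⬝ᵥ matSH x a b Y *ᵥ c := by
  rw [rssNull_eq hR hx hab, add_sub_cancel_left, matSH, sqrtD_mul_matZ, ← weightedCentring,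
    dotProduct_transpose_mul_mul]
  have hw : (mapZ x a b * stack Y) *ᵥ c =
      fun r => √(weight x a b r) * (contrast (x r) a b ⬝ᵥ Y r *ᵥ c) := by
    ext r
    rw [mulVec, dotProduct]
    simp only [mapZ_mul_stack_apply, mul_assoc]
    rw [← Finset.mul_sum, dotProduct_mulVec]
    rfl
  have hJ : ∀ w : Fin R → ℝ, weightedCentring x a b *ᵥ w = fun r =>
      w r - (∑ r, weight x a b r)⁻¹ * (√(weight x a b r) * ∑ r', √(weight x a b r') * w r') := by
    intro w
    ext r
    rw [weightedCentring, sub_mulVec, one_mulVec, smul_mulVec, Pi.sub_apply, Pi.smul_apply,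
      smul_eq_mul]
    simp only [mulVec, dotProduct, sqrtD_ones_apply]
    simp only [mul_assoc, ← Finset.mul_sum]
  have hsq : ∀ r, √(weight x a b r) * √(weight x a b r) = weight x a b r := fun r =>
    Real.mul_self_sqrt (weight_pos hx hab r).le
  rw [hw, hJ, dotProduct]
  simp only [← mul_assoc, hsq]
  simp only [mul_sub, Finset.sum_sub_distrib]
  congr 1
  · refine Finset.sum_congr rfl fun r _ => ?_
    nth_rewrite 1 [← hsq r]
    ring
  · set σ := ∑ r, weight x a b r * (contrast (x r) a b ⬝ᵥ Y r *ᵥ c) with hσ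
    have : ∀ r, √(weight x a b r) * (contrast (x r) a b ⬝ᵥ Y r *ᵥ c) *
        ((∑ r, weight x a b r)⁻¹ * √(weight x a b r) * σ) =
        (∑ r, weight x a b r)⁻¹ * σ * (weight x a b r * (contrast (x r) a b ⬝ᵥ Y r *ᵥ c)) := by
      intro r
      conv_rhs => rw [← hsq r]
      ring
    simp only [← mul_assoc] at this ⊢
    simp only [this]
    simp only [mul_assoc, ← Finset.mul_sum]
    rw [← hσ]
    ring

/-- The `F` statistic in the direction `c` is a ratio of quadratic forms. -/
theorem fStat_eq {q : ℕ} (hR : 2 ≤ R) (hx : ∀ r, (design (x r)).rank = 2) {a b : ℝ}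
    (hab : a ≠ 0 ∨ b ≠ 0) (Y : Data n q) (c : Fin q → ℝ) :
    fStat x a b Y c = (((∑ r, n r : ℕ) : ℝ) - 2 * R) / ((R : ℝ) - 1) *
      ((c ⬝ᵥ matSH x a b Y *ᵥ c) / (c ⬝ᵥ matSE x Y *ᵥ c)) := by
  rw [fStat, rssNull_sub_rssFull_mulVec hR hx hab, rssFull_mulVec hx]
  rw [div_div_div_eq, div_mul_div_comm, mul_comm (c ⬝ᵥ _)]

end

/-! ### Roy's test as a union-intersection test -/

/-- In the coordinates T'c both forms are diagonal. The first coordinate vector attains the largest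
quotient l_0; conversely, if l_0/(1+l_0) < t, every diagonal term falls short and so does the whole
form at any c ≠ 0. -/
theorem le_royRoot_iff {p : ℕ} (hp : 0 < p) {A B : Matrix (Fin p) (Fin p) ℝ}
    (hA : A.PosSemidef) (hB : B.PosDef) {t : ℝ} (ht : t < 1) :
    t ≤ royRoot A B ↔ ∃ c : Fin p → ℝ, c ≠ 0 ∧
      t / (1 - t) ≤ (c ⬝ᵥ A *ᵥ c) / (c ⬝ᵥ B *ᵥ c) := by
  have hBpos : ∀ c : Fin p → ℝ, c ≠ 0 → 0 < c ⬝ᵥ B *ᵥ c := fun c hc => by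
    simpa using hB.dotProduct_mulVec_pos hc
  have key : ∀ c : Fin p → ℝ, c ≠ 0 → (t / (1 - t) ≤ (c ⬝ᵥ A *ᵥ c) / (c ⬝ᵥ B *ᵥ c) ↔
      t * (c ⬝ᵥ (A + B) *ᵥ c) ≤ c ⬝ᵥ A *ᵥ c) := fun c hc => by
    rw [div_le_div_iff₀ (by linarith) (hBpos c hc), add_mulVec, dotProduct_add]
    constructor <;> intro h <;> linarith
  obtain ⟨T, l, hT, hl, h0, rfl, rfl⟩ := exists_simultaneous_diagonalization hA hB
  have hsum : T * diagonal l * Tᵀ + T * Tᵀ = T * diagonal (fun i => 1 + l i) * Tᵀ := by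
    have : diagonal (fun i => 1 + l i) = 1 + diagonal l := by
      rw [← diagonal_one, diagonal_add]
    rw [this, Matrix.mul_add, Matrix.add_mul, Matrix.mul_one, add_comm]
  rw [hsum] at key
  simp only [quadForm_mul_diagonal (d := fun i => 1 + l i)] at key
  rw [royRoot_congr hT hl h0 hp, le_div_iff₀ (by have := h0 ⟨0, hp⟩; positivity)]
  constructor
  · intro h
    have hT' : IsUnit Tᵀ.det := by rwa [det_transpose]
    have hc : Tᵀ *ᵥ (Tᵀ⁻¹ *ᵥ Pi.single (⟨0, hp⟩ : Fin p) (1 : ℝ)) = Pi.single ⟨0, hp⟩ 1 := by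
      rw [mulVec_mulVec, mul_nonsing_inv _ hT', one_mulVec]
    have hne : Tᵀ⁻¹ *ᵥ Pi.single (⟨0, hp⟩ : Fin p) (1 : ℝ) ≠ 0 := fun h => by
      rw [h, mulVec_zero] at hc
      have := congrFun hc ⟨0, hp⟩
      simp at this
    refine ⟨_, hne, (key _ hne).2 ?_⟩
    rw [quadForm_mul_diagonal, hc]
    simpa [Pi.single_apply, ite_pow] using h
  · rintro ⟨c, hc, h⟩
    have h1 := (key c hc).1 h
    rw [quadForm_mul_diagonal, Finset.mul_sum] at h1
    by_contra! hlt
    have hTc : ∃ i, (Tᵀ *ᵥ c) i ≠ 0 := by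
      by_contra! hall
      have hT' : IsUnit Tᵀ.det := by rwa [det_transpose]
      apply hc
      have : Tᵀ⁻¹ *ᵥ (Tᵀ *ᵥ c) = 0 := by
        rw [show Tᵀ *ᵥ c = 0 from funext hall, mulVec_zero]
      rwa [mulVec_mulVec, nonsing_inv_mul _ hT', one_mulVec] at this
    obtain ⟨i, hi⟩ := hTc
    -- Equivalent to (1 - t) l_j < t, which passes from l_0 to the smaller l_j because t < 1.
    have hlt' : ∀ j, l j < t * (1 + l j) := fun j => by
      have := hl (show (⟨0, hp⟩ : Fin p) ≤ j from Fin.mk_le_of_le_val (Nat.zero_le _))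
      nlinarith
    refine absurd h1 (not_le.2 (Finset.sum_lt_sum (fun j _ => ?_) ⟨i, Finset.mem_univ _, ?_⟩))
    · nlinarith [hlt' j, sq_nonneg ((Tᵀ *ᵥ c) j)]
    · have : 0 < (Tᵀ *ᵥ c) i ^ 2 := by positivity
      nlinarith [hlt' i]

/-! ### The statistics through the nonzero eigenvalues -/

theorem isGreatest_eigenvalue {p : ℕ} (hp : 0 < p) {A B : Matrix (Fin p) (Fin p) ℝ}
    (hA : A.PosSemidef) (hB : B.PosDef) :
    IsGreatest {t : ℝ | Module.End.HasEigenvalue (Matrix.toLin' (A * B⁻¹)) t} (lam A B 0) := by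
  have hroot : ∀ t : ℝ, Module.End.HasEigenvalue (Matrix.toLin' (A * B⁻¹)) t ↔
      t ∈ (A * B⁻¹).charpoly.roots := fun t => by
    rw [Module.End.hasEigenvalue_iff_isRoot_charpoly, Matrix.charpoly_toLin',
      Polynomial.mem_roots (charpoly_monic _).ne_zero]
  simp only [hroot]
  obtain ⟨T, l, hT, hl, h0, rfl, rfl⟩ := exists_simultaneous_diagonalization hA hB
  rw [lam_congr hT hl, dif_pos hp, mul_inv_congr hT, roots_charpoly_conj_diagonal hT]
  refine ⟨Multiset.mem_map_of_mem l (Finset.mem_univ_val (⟨0, hp⟩ : Fin p)), ?_⟩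
  intro t ht
  rw [Set.mem_ofPred_eq, Multiset.mem_map] at ht
  obtain ⟨i, -, rfl⟩ := ht
  exact hl (Fin.mk_le_of_le_val (Nat.zero_le _))

/-- The rank counts the nonzero entries of `l`, and for a decreasing nonnegative `l` these form an
initial segment. -/
theorem pos_iff_lt_rank {p : ℕ} {T : Matrix (Fin p) (Fin p) ℝ} (hT : IsUnit T.det) {l : Fin p → ℝ}
    (hl : Antitone l) (h0 : ∀ i, 0 ≤ l i) (i : Fin p) :
    0 < l i ↔ (i : ℕ) < (T * diagonal l * Tᵀ).rank := by
  have hT' : IsUnit Tᵀ.det := by rwa [det_transpose]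
  rw [rank_mul_eq_left_of_isUnit_det _ _ hT', rank_mul_eq_right_of_isUnit_det _ _ hT,
    rank_diagonal, Fintype.card_subtype]
  constructor
  · intro hi
    have : Finset.Iic i ⊆ Finset.univ.filter fun j => l j ≠ 0 := fun j hj => by
      have := hl (Finset.mem_Iic.1 hj)
      simpa using (hi.trans_le this).ne'
    have := Finset.card_le_card this
    rw [Fin.card_Iic] at this
    omega
  · intro hi
    by_contra! hc
    have : (Finset.univ.filter fun j => l j ≠ 0) ⊆ Finset.Iio i := fun j hj => by
      rw [Finset.mem_Iio]
      by_contra! hij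
      have := hl hij
      exact (Finset.mem_filter.1 hj).2 (le_antisymm (this.trans hc) (h0 j))
    have := Finset.card_le_card this
    rw [Fin.card_Iio] at this
    omega

theorem statistics_of_rank {q s : ℕ} {A B : Matrix (Fin q) (Fin q) ℝ}
    (hA : A.PosSemidef) (hB : B.PosDef) (hs : A.rank = s) :
    (∀ i < s, 0 < lam A B i) ∧ (∀ i, s ≤ i → lam A B i = 0) ∧
    (∀ i < s, theta A B i = lam A B i / (1 + lam A B i)) ∧
    royRoot A B = lam A B 0 / (1 + lam A B 0) ∧
    pillai A B = ∑ i ∈ Finset.range s, lam A B i / (1 + lam A B i) ∧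
    pillai A B = ∑ i ∈ Finset.range s, theta A B i ∧
    lawleyHotelling A B = ∑ i ∈ Finset.range s, lam A B i ∧
    lawleyHotelling A B = ∑ i ∈ Finset.range s, theta A B i / (1 - theta A B i) := by
  have hsq : s ≤ q := hs ▸ rank_le_width _
  obtain ⟨T, l, hT, hl, h0, rfl, rfl⟩ := exists_simultaneous_diagonalization hA hB
  have hpos := pos_iff_lt_rank hT hl h0
  rw [hs] at hpos
  have hlam := lam_congr hT hl
  have hth : ∀ i, theta (T * diagonal l * Tᵀ) (T * Tᵀ) i =
      lam (T * diagonal l * Tᵀ) (T * Tᵀ) i / (1 + lam (T * diagonal l * Tᵀ) (T * Tᵀ) i) := fun i => by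
    rw [theta_congr hT hl h0, hlam]
    split_ifs <;> simp
  have hlpos : ∀ i < s, 0 < lam (T * diagonal l * Tᵀ) (T * Tᵀ) i := fun i hi => by
    rw [hlam, dif_pos (hi.trans_le hsq)]
    exact (hpos _).2 hi
  have hzero : ∀ i, s ≤ i → lam (T * diagonal l * Tᵀ) (T * Tᵀ) i = 0 := fun i hi => by
    rw [hlam]
    split_ifs with h
    · exact le_antisymm (not_lt.1 fun h' => absurd ((hpos _).1 h') (not_lt.2 hi)) (h0 _)
    · rfl
  have hsum : ∀ f : ℝ → ℝ, f 0 = 0 → ∑ i, f (l i) =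
      ∑ i ∈ Finset.range s, f (lam (T * diagonal l * Tᵀ) (T * Tᵀ) i) := fun f hf => by
    have h1 : ∑ i, f (l i) = ∑ i ∈ Finset.range q, f (lam (T * diagonal l * Tᵀ) (T * Tᵀ) i) := by
      rw [← Fin.sum_univ_eq_sum_range (fun i => f (lam (T * diagonal l * Tᵀ) (T * Tᵀ) i))]
      refine Finset.sum_congr rfl fun i _ => ?_
      rw [hlam, dif_pos i.2]
    rw [h1]
    refine (Finset.sum_subset (Finset.range_mono hsq) fun i _ hi => ?_).symm
    rw [hzero i (by simpa using hi), hf]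
  have hp : pillai (T * diagonal l * Tᵀ) (T * Tᵀ) = ∑ i ∈ Finset.range s,
      lam (T * diagonal l * Tᵀ) (T * Tᵀ) i / (1 + lam (T * diagonal l * Tᵀ) (T * Tᵀ) i) := by
    rw [pillai_congr hT h0, hsum (fun x => x / (1 + x)) (by simp)]
  have hL : lawleyHotelling (T * diagonal l * Tᵀ) (T * Tᵀ) = ∑ i ∈ Finset.range s,
      lam (T * diagonal l * Tᵀ) (T * Tᵀ) i := by
    rw [lawleyHotelling_congr hT, hsum (fun x => x) rfl]
  refine ⟨hlpos, hzero, fun i _ => hth i, hth 0, hp, ?_, hL, ?_⟩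
  · simp only [hth, hp]
  · rw [hL]
    refine Finset.sum_congr rfl fun i hi => ?_
    have := hlpos i (Finset.mem_range.1 hi)
    rw [hth]
    field_simp
    ring

/-! ### The law of the errors -/

open scoped MatrixOrder in
theorem exists_sqrt_multivariateGaussian {q : ℕ} {Sig : Matrix (Fin q) (Fin q) ℝ}
    (hSig : Sig.PosDef) : ∃ C : Matrix (Fin q) (Fin q) ℝ, IsUnit C.det ∧
      multivariateGaussian (0 : EuclideanSpace ℝ (Fin q)) Sig =
        (Measure.pi fun _ : Fin q => gaussianReal 0 1).map fun v => WithLp.toLp 2 (C *ᵥ v) := by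
  refine ⟨CFC.sqrt Sig, ?_, ?_⟩
  · have h := congrArg Matrix.det (CFC.sqrt_mul_sqrt_self Sig hSig.posSemidef.nonneg)
    rw [det_mul] at h
    refine isUnit_iff_ne_zero.2 fun h0 => hSig.det_pos.ne' ?_
    rw [← h, h0, zero_mul]
  · rw [multivariateGaussian, ← map_pi_eq_stdGaussian, Measure.map_map (by fun_prop) (by fun_prop)]
    congr 1
    ext1 v
    simp

/-- With C the square root of Σ, the error rows have the law of Cg with g standard Gaussian. Stacked
as rows, they become W C', whence M = C'. -/
theorem NormalErrors.exists_whitening {Ω : Type*} [MeasurableSpace Ω] {P : Measure Ω} {R q : ℕ}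
    {n : Fin R → ℕ} {Sig : Matrix (Fin q) (Fin q) ℝ} (hSig : Sig.PosDef) {ε : Ω → Data n q}
    (hε : NormalErrors P Sig ε) :
    ∃ (M : Matrix (Fin q) (Fin q) ℝ) (W : Ω → Matrix ((r : Fin R) × Fin (n r)) (Fin q) ℝ),
      IsUnit M.det ∧ HasLaw W (gauss ((r : Fin R) × Fin (n r)) (Fin q)) P ∧
      ∀ ω, stack (ε ω) = W ω * M := by
  obtain ⟨C, hC, hlaw⟩ := exists_sqrt_multivariateGaussian hSig
  have hC' : IsUnit Cᵀ.det := by rwa [det_transpose]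
  let φ : (((r : Fin R) × Fin (n r)) → EuclideanSpace ℝ (Fin q)) →
      Matrix ((r : Fin R) × Fin (n r)) (Fin q) ℝ := fun e => (Matrix.of fun p => (e p).ofLp) * Cᵀ⁻¹
  have hφ : Measurable φ := by
    refine measurable_matrixMul ?_ measurable_const
    refine measurable_pi_lambda _ fun p => measurable_pi_lambda _ fun j => ?_
    change Measurable fun e : ((r : Fin R) × Fin (n r)) → EuclideanSpace ℝ (Fin q) => (e p).ofLp j
    fun_prop
  refine ⟨Cᵀ, fun ω => stack (ε ω) * Cᵀ⁻¹, hC', ?_, fun ω => ?_⟩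
  · have h2 : HasLaw φ (gauss ((r : Fin R) × Fin (n r)) (Fin q))
        (Measure.pi fun _ : (r : Fin R) × Fin (n r) =>
          multivariateGaussian (0 : EuclideanSpace ℝ (Fin q)) Sig) := by
      refine ⟨hφ.aemeasurable, ?_⟩
      have hm : Measurable fun v : Fin q → ℝ => WithLp.toLp 2 (C *ᵥ v) := by
        have : Continuous fun v : Fin q → ℝ => WithLp.toLp 2 (C *ᵥ v) := by fun_prop
        exact this.measurable
      have : IsProbabilityMeasure ((Measure.pi fun _ : Fin q => gaussianReal 0 1).map
          fun v => WithLp.toLp 2 (C *ᵥ v)) := Measure.isProbabilityMeasure_map hm.aemeasurable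
      rw [hlaw, ← Measure.pi_map_pi (fun _ => hm.aemeasurable), Measure.map_map hφ (by fun_prop)]
      have hid : (φ ∘ fun (G : ((r : Fin R) × Fin (n r)) → Fin q → ℝ) p =>
          WithLp.toLp 2 (C *ᵥ G p)) = id := by
        ext1 G
        have h3 : (Matrix.of fun p => C *ᵥ G p) = (Matrix.of G) * Cᵀ := by
          ext p j
          simp [mulVec, dotProduct, mul_apply, mul_comm]
        change (Matrix.of fun p => C *ᵥ G p) * Cᵀ⁻¹ = G
        rw [h3, Matrix.mul_assoc, mul_nonsing_inv _ hC', Matrix.mul_one]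
        rfl
      rw [hid]
      exact Measure.map_id
    exact h2.comp hε
  · rw [Matrix.mul_assoc, nonsing_inv_mul _ hC', Matrix.mul_one]

/-! ### Conjugation -/

theorem posDef_conj {q : ℕ} {M B : Matrix (Fin q) (Fin q) ℝ} (hM : IsUnit M.det) (hB : B.PosDef) :
    (Mᵀ * B * M).PosDef := by
  have := hB.conjTranspose_mul_mul_same (B := M)
    (Matrix.mulVec_injective_iff_isUnit.2 ((Matrix.isUnit_iff_isUnit_det _).2 hM))
  simpa only [conjTranspose_eq_transpose_of_trivial] using this

theorem posSemidef_conj {q : ℕ} {M B : Matrix (Fin q) (Fin q) ℝ} (hB : B.PosSemidef) :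
    (Mᵀ * B * M).PosSemidef := by
  have := hB.conjTranspose_mul_mul_same M
  simpa only [conjTranspose_eq_transpose_of_trivial] using this

theorem conj_mul {ι : Type*} [Fintype ι] {q : ℕ} (P : Matrix ι ι ℝ) (G : Matrix ι (Fin q) ℝ)
    (M : Matrix (Fin q) (Fin q) ℝ) : (G * M)ᵀ * P * (G * M) = Mᵀ * (Gᵀ * P * G) * M := by
  rw [transpose_mul]
  simp only [Matrix.mul_assoc]

/-! ### The laws of S_H and S_E in the model -/

section

variable {R q : ℕ} {n : Fin R → ℕ} {x : (r : Fin R) → Fin (n r) → ℝ} {a b : ℝ}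

theorem response_stack (x : (r : Fin R) → Fin (n r) → ℝ) (B : Params R q) (ε : Data n q) :
    stack (response x B ε) = stack (fun r => design (x r) * B r) + stack ε := rfl

theorem matSE_response (hx : ∀ r, (design (x r)).rank = 2) (B : Params R q) (ε : Data n q) :
    matSE x (response x B ε) = (stack ε)ᵀ * projE x * stack ε := by
  rw [matSE_eq, response_stack,
    transpose_mul_mul_add_of_mul_eq_zero (transpose_projE x) (projE_mul_stack_mean hx B)]

theorem matSH_response_of_nullHyp (hR : 2 ≤ R) (hx : ∀ r, (design (x r)).rank = 2)
    (hab : a ≠ 0 ∨ b ≠ 0) {B : Params R q} (hB : NullHyp a b B) (ε : Data n q) :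
    matSH x a b (response x B ε) = (stack ε)ᵀ * projH x a b * stack ε := by
  rw [matSH_eq, response_stack, transpose_mul_mul_add_of_mul_eq_zero (transpose_projH x a b)
    (projH_mul_stack_mean hR hx hab hB)]

theorem posSemidef_projH_conj (hR : 2 ≤ R) (hx : ∀ r, (design (x r)).rank = 2)
    (hab : a ≠ 0 ∨ b ≠ 0) (G : Matrix ((r : Fin R) × Fin (n r)) (Fin q) ℝ) :
    (Gᵀ * projH x a b * G).PosSemidef := by
  have h : Gᵀ * projH x a b * G = (projH x a b * G)ᵀ * (projH x a b * G) := by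
    rw [transpose_mul, transpose_projH, Matrix.mul_assoc, Matrix.mul_assoc,
      ← Matrix.mul_assoc (projH x a b) (projH x a b), projH_mul_self hR hx hab]
  rw [h]
  exact posSemidef_gram _

theorem posSemidef_matSH (hR : 2 ≤ R) (hx : ∀ r, (design (x r)).rank = 2)
    (hab : a ≠ 0 ∨ b ≠ 0) (Y : Data n q) : (matSH x a b Y).PosSemidef := by
  rw [matSH_eq]
  exact posSemidef_projH_conj hR hx hab _

theorem map_gauss_proj (hR : 2 ≤ R) (hx : ∀ r, (design (x r)).rank = 2) (hab : a ≠ 0 ∨ b ≠ 0)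
    {k : ℕ} (hk : k + 2 * R = ∑ r, n r) (q : ℕ) :
    (gauss ((r : Fin R) × Fin (n r)) (Fin q)).map
      (fun G => (Gᵀ * projH x a b * G, Gᵀ * projE x * G)) = wishartPair (R - 1) k q := by
  refine map_gauss_eq_wishartPair (transpose_projH x a b) (transpose_projE x)
    (projH_mul_self hR hx hab) (projE_mul_self hx) (projH_mul_projE hx a b)
    (trace_projH hR hx hab) ?_ q
  rw [trace_projE hx, ← hk]
  push_cast
  ring

theorem measurable_projPair (x : (r : Fin R) → Fin (n r) → ℝ) (a b : ℝ) :
    Measurable fun G : Matrix ((r : Fin R) × Fin (n r)) (Fin q) ℝ =>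
      (Gᵀ * projH x a b * G, Gᵀ * projE x * G) := by
  have : Continuous fun G : Matrix ((r : Fin R) × Fin (n r)) (Fin q) ℝ =>
      (Gᵀ * projH x a b * G, Gᵀ * projE x * G) := by fun_prop
  exact this.measurable

theorem ae_gauss_good (hR : 2 ≤ R) (hx : ∀ r, (design (x r)).rank = 2) (hab : a ≠ 0 ∨ b ≠ 0)
    {k : ℕ} (hk : k + 2 * R = ∑ r, n r) (hqk : q ≤ k) :
    ∀ᵐ G ∂gauss ((r : Fin R) × Fin (n r)) (Fin q),
      (Gᵀ * projH x a b * G, Gᵀ * projE x * G) ∈ goodPairs q :=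
  ae_of_ae_map (measurable_projPair x a b).aemeasurable
    (map_gauss_proj hR hx hab hk q ▸ ae_wishartPair_good hqk)

variable {Ω : Type*} [MeasurableSpace Ω] {P : Measure Ω} {Sig : Matrix (Fin q) (Fin q) ℝ}
  {ε : Ω → Data n q}

theorem ae_posDef_matSE (hR : 2 ≤ R) (hx : ∀ r, (design (x r)).rank = 2) (hab : a ≠ 0 ∨ b ≠ 0)
    {k : ℕ} (hk : k + 2 * R = ∑ r, n r) (hqk : q ≤ k) (hSig : Sig.PosDef)
    (hε : NormalErrors P Sig ε) (B : Params R q) :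
    ∀ᵐ ω ∂P, (matSE x (response x B (ε ω))).PosDef := by
  obtain ⟨M, W, hM, hW, hεW⟩ := hε.exists_whitening hSig
  have h := ae_gauss_good (q := q) hR hx hab hk hqk
  rw [← hW.map_eq] at h
  filter_upwards [ae_of_ae_map hW.aemeasurable h] with ω hω
  rw [matSE_response hx, hεW, conj_mul]
  exact posDef_conj hM hω.2

/-- With P_H = V'V, S_H is the Gram matrix of VY = (VAM⁻¹ + VW)M, where A is the mean. VW is a
standard Gaussian (R-1) × q matrix, and the shift by the mean does not affect full rank; no null
hypothesis is needed. -/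
theorem ae_rank_matSH (hR : 2 ≤ R) (hx : ∀ r, (design (x r)).rank = 2) (hab : a ≠ 0 ∨ b ≠ 0)
    (hSig : Sig.PosDef) (hε : NormalErrors P Sig ε) (B : Params R q) :
    ∀ᵐ ω ∂P, (matSH x a b (response x B (ε ω))).rank = min q (R - 1) := by
  obtain ⟨M, W, hM, hW, hεW⟩ := hε.exists_whitening hSig
  obtain ⟨V, hV, hVP⟩ := exists_semiorthogonal (transpose_projH x a b) (projH_mul_self hR hx hab)
    (trace_projH hR hx hab)
  set A := stack (fun r => design (x r) * B r) with hA
  have h := ae_rank_add (R - 1) q (V * A * M⁻¹)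
  rw [← map_gauss_mul_left hV] at h
  have h2 := ae_of_ae_map (measurable_mul_left V).aemeasurable h
  rw [← hW.map_eq] at h2
  filter_upwards [ae_of_ae_map hW.aemeasurable h2] with ω hω
  have h3 : (stack (response x B (ε ω)))ᵀ * projH x a b * stack (response x B (ε ω)) =
      (V * stack (response x B (ε ω)))ᵀ * (V * stack (response x B (ε ω))) := by
    rw [← hVP, transpose_mul]
    simp only [Matrix.mul_assoc]
  have h4 : V * stack (response x B (ε ω)) = (V * A * M⁻¹ + V * W ω) * M := by
    rw [response_stack, hεW, Matrix.add_mul, Matrix.mul_assoc (V * A), nonsing_inv_mul _ hM,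
      Matrix.mul_one, Matrix.mul_add, Matrix.mul_assoc V (W ω)]
  rw [matSH_eq, h3, rank_transpose_mul_self, h4, rank_mul_eq_left_of_isUnit_det _ _ hM, hω,
    min_comm]

/-- Under the null hypothesis a spectral statistic has the same upper tails as for independent
Wishart matrices. -/
theorem measure_le_stat_of_nullHyp
    {T : {p : ℕ} → Matrix (Fin p) (Fin p) ℝ → Matrix (Fin p) (Fin p) ℝ → ℝ} (hT : IsSpectralStat T)
    (hR : 2 ≤ R) (hq : 0 < q) (hx : ∀ r, (design (x r)).rank = 2) (hab : a ≠ 0 ∨ b ≠ 0)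
    {k : ℕ} (hk : k + 2 * R = ∑ r, n r) (hqk : q ≤ k) (hSig : Sig.PosDef)
    (hε : NormalErrors P Sig ε) {B : Params R q} (hB : NullHyp a b B) (t : ℝ) :
    P {ω | t ≤ T (matSH x a b (response x B (ε ω))) (matSE x (response x B (ε ω)))} =
      wishartPair (R - 1) k q {w | t ≤ onGood T w} := by
  obtain ⟨M, W, hM, hW, hεW⟩ := hε.exists_whitening hSig
  have hgood := ae_gauss_good (q := q) hR hx hab hk hqk
  rw [← hW.map_eq] at hgood
  have hm : MeasurableSet {w | t ≤ onGood T (p := q) w} :=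
    measurableSet_le measurable_const (hT.measurable_onGood hq)
  rw [← map_gauss_proj hR hx hab hk q, Measure.map_apply (measurable_projPair x a b) hm,
    ← hW.map_eq, Measure.map_apply_of_aemeasurable hW.aemeasurable (measurable_projPair x a b hm)]
  refine measure_congr ?_
  filter_upwards [ae_of_ae_map hW.aemeasurable hgood] with ω hω
  -- Both means vanish, and the remaining factor M acts as a congruence, which `nzRoots_conj`
  -- absorbs.
  have h1 : T (matSH x a b (response x B (ε ω))) (matSE x (response x B (ε ω))) =
      onGood T ((W ω)ᵀ * projH x a b * W ω, (W ω)ᵀ * projE x * W ω) := by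
    rw [onGood_of_mem T hω, matSE_response hx, matSH_response_of_nullHyp hR hx hab hB, hεW,
      conj_mul, conj_mul]
    exact hT.congr hq hq (posSemidef_conj hω.1) (posDef_conj hM hω.2) hω.1 hω.2 (nzRoots_conj hM _ _)
  exact congrArg (t ≤ ·) h1

theorem nullHyp_iff_forall_nullHypDir (B : Params R q) :
    NullHyp a b B ↔ ∀ c : Fin q → ℝ, c ≠ 0 → NullHypDir a b B c := by
  refine ⟨fun h c _ r r' => by rw [h r r'], fun h r r' => ?_⟩
  ext j
  have := h (Pi.single j 1) (by simp) r r'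
  simpa using this

end

/-! ### The range of Roy's critical value -/

theorem royRoot_lt_one {p : ℕ} (hp : 0 < p) {A B : Matrix (Fin p) (Fin p) ℝ}
    (hA : A.PosSemidef) (hB : B.PosDef) : royRoot A B < 1 := by
  obtain ⟨T, l, hT, hl, h0, rfl, rfl⟩ := exists_simultaneous_diagonalization hA hB
  have := h0 ⟨0, hp⟩
  rw [royRoot_congr hT hl h0 hp, div_lt_one (by positivity)]
  linarith

/-- The largest root lies in [0, 1) almost surely. A critical value ≤ 0 would reject with
probability 1 and one ≥ 1 with probability 0, but the rejection probability is α. -/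
theorem critical_royRoot_mem {q k₁ k₂ s : ℕ} (hq : 0 < q) (hk₁ : 0 < k₁)
    (hqk : q ≤ k₂) (hs : s = min q k₁) {m h : ℝ} (hm : m = (|(q : ℝ) - k₁| - 1) / 2)
    (hh : h = ((k₂ : ℝ) - q - 1) / 2) {α : ℝ} (hα0 : 0 < α) (hα1 : α < 1) :
    0 < critical royRoot α s m h ∧ critical royRoot α s m h < 1 := by
  have hc := wishartPair_critical_le isSpectralStat_royRoot hq hk₁ hqk hs hm hh hα0 hα1
  have hgood := ae_wishartPair_good (k₁ := k₁) hqk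
  constructor
  · by_contra! hle
    have h1 : wishartPair k₁ k₂ q {w | critical royRoot α s m h ≤ onGood royRoot w} = 1 := by
      rw [← measure_univ (μ := wishartPair k₁ k₂ q)]
      refine measure_congr ?_
      filter_upwards [hgood] with w hw
      refine propext ⟨fun _ => trivial, fun _ => ?_⟩
      refine hle.trans ?_
      rw [onGood_of_mem _ hw]
      exact isSpectralStat_royRoot.nonneg hq hw.1 hw.2
    rw [h1] at hc
    exact absurd hc.symm (ne_of_lt (by simpa using hα1))
  · by_contra! hle
    have h1 : wishartPair k₁ k₂ q {w | critical royRoot α s m h ≤ onGood royRoot w} = 0 := by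
      rw [← measure_empty (μ := wishartPair k₁ k₂ q)]
      refine measure_congr ?_
      filter_upwards [hgood] with w hw
      refine propext ⟨fun h => ?_, fun h => h.elim⟩
      have h2 : critical royRoot α s m _ ≤ onGood royRoot w := h
      rw [onGood_of_mem _ hw] at h2
      linarith [royRoot_lt_one hq hw.1 hw.2]
    rw [h1] at hc
    exact absurd hc (ne_of_lt (by simpa using hα0))

end MultiLines

theorem theorem2 {R q : ℕ} (hR : 2 ≤ R) (hq : 1 ≤ q)
    (n : Fin R → ℕ) (hn : ∀ r, q + 2 < n r)
    (x : (r : Fin R) → Fin (n r) → ℝ) (hx : ∀ r, (MultiLines.design (x r)).rank = 2)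
    (a b : ℝ) (hab : a ≠ 0 ∨ b ≠ 0)
    (α : ℝ) (hα0 : 0 < α) (hα1 : α < 1)
    (νH νE m h : ℝ) (s : ℕ)
    (hνH : νH = (R : ℝ) - 1) (hνE : νE = ((∑ r, n r : ℕ) : ℝ) - 2 * R)
    (hs : s = min q (R - 1)) (hm : m = (|(q : ℝ) - νH| - 1) / 2) (hh : h = (νE - q - 1) / 2)
    {Ω : Type*} [MeasurableSpace Ω] (P : Measure Ω) [IsProbabilityMeasure P]
    (B : MultiLines.Params R q) (Sig : Matrix (Fin q) (Fin q) ℝ) (hSig : Sig.PosDef)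
    (ε : Ω → MultiLines.Data n q) (hε : MultiLines.NormalErrors P Sig ε)
    (Y : Ω → MultiLines.Data n q) (hY : ∀ ω, Y ω = MultiLines.response x B (ε ω))
    (SH SE : Ω → Matrix (Fin q) (Fin q) ℝ)
    (hSH : ∀ ω, SH ω = MultiLines.matSH x a b (Y ω))
    (hSE : ∀ ω, SE ω = MultiLines.matSE x (Y ω)) :
    -- under the null hypothesis, each of the three tests rejects with probability `α`
    (MultiLines.NullHyp a b B →
      P {ω | MultiLines.critical MultiLines.royRoot α s m h
          ≤ MultiLines.royRoot (SH ω) (SE ω)} = ENNReal.ofReal α ∧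
      P {ω | MultiLines.critical MultiLines.pillai α s m h
          ≤ MultiLines.pillai (SH ω) (SE ω)} = ENNReal.ofReal α ∧
      P {ω | MultiLines.critical MultiLines.lawleyHotelling α s m h
          ≤ MultiLines.lawleyHotelling (SH ω) (SE ω)} = ENNReal.ofReal α) ∧
    -- the expressions of the three statistics through the nonzero eigenvalues
    (∀ᵐ ω ∂P,
      (SE ω).PosDef ∧
      IsGreatest {l : ℝ | Module.End.HasEigenvalue (Matrix.toLin' (SH ω * (SE ω)⁻¹)) l}
        (MultiLines.lam (SH ω) (SE ω) 0) ∧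
      (∀ i < s, 0 < MultiLines.lam (SH ω) (SE ω) i) ∧
      (∀ i, s ≤ i → MultiLines.lam (SH ω) (SE ω) i = 0) ∧
      (∀ i < s, MultiLines.theta (SH ω) (SE ω) i =
        MultiLines.lam (SH ω) (SE ω) i / (1 + MultiLines.lam (SH ω) (SE ω) i)) ∧
      MultiLines.royRoot (SH ω) (SE ω) =
        MultiLines.lam (SH ω) (SE ω) 0 / (1 + MultiLines.lam (SH ω) (SE ω) 0) ∧
      MultiLines.pillai (SH ω) (SE ω) =
        ∑ i ∈ Finset.range s,
          MultiLines.lam (SH ω) (SE ω) i / (1 + MultiLines.lam (SH ω) (SE ω) i) ∧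
      MultiLines.pillai (SH ω) (SE ω) =
        ∑ i ∈ Finset.range s, MultiLines.theta (SH ω) (SE ω) i ∧
      MultiLines.lawleyHotelling (SH ω) (SE ω) =
        ∑ i ∈ Finset.range s, MultiLines.lam (SH ω) (SE ω) i ∧
      MultiLines.lawleyHotelling (SH ω) (SE ω) =
        ∑ i ∈ Finset.range s,
          MultiLines.theta (SH ω) (SE ω) i / (1 - MultiLines.theta (SH ω) (SE ω) i)) ∧
    -- Roy's test is the union-intersection test: the null hypothesis is the intersection of the
    -- component hypotheses, and the rejection region is the union of the rejection regions of
    -- the univariate `F` tests of these, all with the same critical value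
    (MultiLines.NullHyp a b B ↔ ∀ c : Fin q → ℝ, c ≠ 0 → MultiLines.NullHypDir a b B c) ∧
    (0 < MultiLines.critical MultiLines.royRoot α s m h ∧
      MultiLines.critical MultiLines.royRoot α s m h < 1) ∧
    (∀ᵐ ω ∂P, ∀ t : ℝ, t < 1 →
      (t ≤ MultiLines.royRoot (SH ω) (SE ω) ↔
        ∃ c : Fin q → ℝ, c ≠ 0 ∧
          νE / νH * (t / (1 - t)) ≤ MultiLines.fStat x a b (Y ω) c)) := by
  have hq' : 0 < q := hq
  have hR1 : 0 < R - 1 := by omega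
  have hN : R * (q + 3) ≤ ∑ r, n r := by
    have := Finset.card_nsmul_le_sum Finset.univ n (q + 3) fun r _ => hn r
    simpa using this
  have hNR : 2 * R + q ≤ ∑ r, n r := by nlinarith
  -- `k` is ν_E as a natural number. From n_r ≥ q + 3 it follows that k ≥ q, which makes S_E almost
  -- surely positive definite.
  obtain ⟨k, hk⟩ : ∃ k, k + 2 * R = ∑ r, n r := ⟨∑ r, n r - 2 * R, by omega⟩
  have hqk : q ≤ k := by omega
  have hνH' : νH = ((R - 1 : ℕ) : ℝ) := by rw [hνH, Nat.cast_sub (by omega), Nat.cast_one]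
  have hνE' : νE = (k : ℝ) := by rw [hνE, ← hk]; push_cast; ring
  rw [hνH'] at hm
  rw [hνE'] at hh
  have hνpos : 0 < νE / νH := by
    rw [hνH', hνE']
    have : 0 < k := by omega
    positivity
  have hPD := MultiLines.ae_posDef_matSE hR hx hab hk hqk hSig hε B
  have hrank := MultiLines.ae_rank_matSH hR hx hab hSig hε B
  -- The three tests are treated at once, through their common spectral properties.
  have htest : ∀ {T : {p : ℕ} → Matrix (Fin p) (Fin p) ℝ → Matrix (Fin p) (Fin p) ℝ → ℝ},
      MultiLines.IsSpectralStat T → MultiLines.NullHyp a b B →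
      P {ω | MultiLines.critical T α s m h ≤ T (SH ω) (SE ω)} = ENNReal.ofReal α := by
    intro T hT hB
    simp only [hSH, hSE, hY]
    rw [MultiLines.measure_le_stat_of_nullHyp hT hR hq' hx hab hk hqk hSig hε hB]
    exact MultiLines.wishartPair_critical_le hT hq' hR1 hqk hs hm hh hα0 hα1
  refine ⟨fun hB => ⟨htest MultiLines.isSpectralStat_royRoot hB,
    htest MultiLines.isSpectralStat_pillai hB,
    htest MultiLines.isSpectralStat_lawleyHotelling hB⟩, ?_,
    MultiLines.nullHyp_iff_forall_nullHypDir B,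
    MultiLines.critical_royRoot_mem hq' hR1 hqk hs hm hh hα0 hα1, ?_⟩
  · filter_upwards [hPD, hrank] with ω hE hr
    rw [hSH, hSE, hY]
    have hA := MultiLines.posSemidef_matSH hR hx hab (MultiLines.response x B (ε ω))
    exact ⟨hE, MultiLines.isGreatest_eigenvalue hq' hA hE,
      MultiLines.statistics_of_rank hA hE (hr.trans hs.symm)⟩
  · filter_upwards [hPD] with ω hE t ht
    rw [hSH, hSE, hY]
    have hA := MultiLines.posSemidef_matSH hR hx hab (MultiLines.response x B (ε ω))
    rw [MultiLines.le_royRoot_iff hq' hA hE ht]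
    refine exists_congr fun c => and_congr_right fun _ => ?_
    rw [MultiLines.fStat_eq hR hx hab, ← hνH, ← hνE, mul_le_mul_iff_right₀ hνpos]
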